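/- Let $r,s\ge 0$ be integers, and let $f_1,\dots,f_r\in\mathbb{Z}[u_1,\dots,u_s]$ be non-zero, pairwise non-proportional linear forms. For $1\le i\le r$ let $K_i$ be a number field of degree $n_i>1$ and discriminant $D_{K_i}$, let $\omega_{i,1},\dots,\omega_{i,n_i}$ be a $\mathbb{Z}$-basis of its ring of integers, and let $\mathbf{N}_{K_i}(\mathbf{x})=N_{K_i/\mathbb{Q}}(x_1\omega_{i,1}+\dots+x_{n_i}\omega_{i,n_i})$ be the associated norm form, a polynomial with integer coefficients. Let $M$ be a positive integer, $\mathbf{a}\in(\mathbb{Z}/M\mathbb{Z})^s$ and $\mathbf{b}_i\in(\mathbb{Z}/M\mathbb{Z})^{n_i}$ for $1\le i\le r$. For a prime $p$ put $v=v_p(M)$ and, for $m\ge v$ and $A\in\mathbb{Z}/p^m\mathbb{Z}$, $$\rho_i(p^m,A;p^{v})=\#\{\mathbf{x}\in(\mathbb{Z}/p^m\mathbb{Z})^{n_i}:\ \mathbf{N}_{K_i}(\mathbf{x})\equiv A \bmod p^m,\ \mathbf{x}\equiv\mathbf{b}_i\bmod p^{v}\},$$ $$\beta_p=\lim_{m\to\infty}\frac{1}{p^{ms}}\sum_{\substack{\mathbf{u}\in(\mathbb{Z}/p^m\mathbb{Z})^s\\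 \mathbf{u}\equiv\mathbf{a}\bmod p^{v}}}\ \prod_{i=1}^r\frac{\rho_i(p^m,f_i(\mathbf{u});p^{v})}{p^{m(n_i-1)}}.$$ Let $L$ be the maximum of $s$, $r$ and, over $1\le i\le r$, of $\|f_i\|$ and $n_i|D_{K_i}|$, where $\|f_i\|$ is the maximum modulus of the coefficients of $f_i$. Then the limit defining $\beta_p$ exists for every prime $p$, and we have $\beta_p=1+O_L(p^{-2})$ whenever $p\nmid M$ and $\beta_p=O_{L,M}(1)$ whenever $p\mid M$; here the first implied constant depends only on $L$, and the second only on $L$ and $M$. In particular, there exists $L'$ depending only on $L$ (and not on $M$) such that $\beta_p>0$ whenever $p>L'$ and $p\nmid M$. Consequently the product $\prod_p\beta_p$ converges absolutely, that is, $\sum_p|\beta_p-1|<\infty$, and the product $\prod_p\beta_p$ is unconditionally convergent. -/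

import Mathlib

open Filter Topology NumberField

noncomputable section

namespace NormFormSystem

/-- The norm form of a number field `K` with respect to a `ℤ`-basis `ω₁, …, ωₙ` of its ring of
integers: the polynomial with integer coefficients in `x₁, …, xₙ` that is the determinant of
multiplication by `x₁ ω₁ + ⋯ + xₙ ωₙ`. -/
def normForm {K : Type*} [Field K] [NumberField K] {n : ℕ} (ω : Module.Basis (Fin n) ℤ (𝓞 K)) :
    MvPolynomial (Fin n) ℤ :=
  (∑ j, (MvPolynomial.X j : MvPolynomial (Fin n) ℤ) •
    (Algebra.leftMulMatrix ω (ω j)).map MvPolynomial.C).det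

/-- The values of the norm form are the field norms `N_{K/ℚ}(x₁ ω₁ + ⋯ + xₙ ωₙ)`. -/
theorem normForm_eval {K : Type*} [Field K] [NumberField K] {n : ℕ}
    (ω : Module.Basis (Fin n) ℤ (𝓞 K)) (x : Fin n → ℤ) :
    ((MvPolynomial.eval x (normForm ω) : ℤ) : ℚ) =
      Algebra.norm ℚ (∑ j, (x j : K) * (ω j : K)) := by
  have h1 : MvPolynomial.eval x (normForm ω) = Algebra.norm ℤ (∑ j, x j • ω j) := by
    rw [Algebra.norm_eq_matrix_det ω, normForm, RingHom.map_det, map_sum]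
    congr 1
    ext k l
    simp [Matrix.sum_apply, -zsmul_eq_mul, -Int.cast_eq]
  rw [h1, Algebra.coe_norm_int]
  congr 1
  simp

/-- `ρ(q, A; d)`: the number of `x ∈ (ℤ/qℤ)ⁿ` with `N_K(x) ≡ A mod q` and `x ≡ b mod d`
(where `d ∣ q`). -/
def rho {K : Type*} [Field K] [NumberField K] {n : ℕ} (ω : Module.Basis (Fin n) ℤ (𝓞 K))
    (q : ℕ) (A : ZMod q) (d : ℕ) (b : Fin n → ZMod d) : ℕ :=
  Set.ncard {x : Fin n → ZMod q |
    MvPolynomial.aeval x (normForm ω) = A ∧ ∀ j, ((x j).cast : ZMod d) = b j}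

/-- The value modulo `q` at `u ∈ (ℤ/qℤ)ˢ` of the linear form with integer coefficient vector
`c`. -/
def linForm {s : ℕ} (c : Fin s → ℤ) (q : ℕ) (u : Fin s → ZMod q) : ZMod q :=
  ∑ j, (c j : ZMod q) * u j

/-- The normalised count of solutions modulo `p ^ m` whose limit as `m → ∞` is the local density:
`p^{-ms} ∑_{u mod p^m, u ≡ a mod p^{v_p(M)}} ∏ᵢ ρᵢ(p^m, fᵢ(u); p^{v_p(M)}) / p^{m(nᵢ - 1)}`.
It is meaningful for `m ≥ v_p(M)`. -/
def localDensityApprox {s r : ℕ} (f : Fin r → Fin s → ℤ)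
    {K : Fin r → Type*} [∀ i, Field (K i)] [∀ i, NumberField (K i)]
    (ω : ∀ i, Module.Basis (Fin (Module.finrank ℚ (K i))) ℤ (𝓞 (K i)))
    (M : ℕ) (a : Fin s → ZMod M) (b : ∀ i, Fin (Module.finrank ℚ (K i)) → ZMod M)
    (p : ℕ) [Fact p.Prime] (m : ℕ) : ℝ :=
  open Classical in
  (1 / (p : ℝ) ^ (m * s)) *
    ∑ u : Fin s → ZMod (p ^ m) with
        ∀ j, ((u j).cast : ZMod (p ^ padicValNat p M)) = (a j).cast,
      ∏ i, (rho (ω i) (p ^ m) (linForm (f i) (p ^ m) u) (p ^ padicValNat p M)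
          (fun j => (b i j).cast) : ℝ) / (p : ℝ) ^ (m * (Module.finrank ℚ (K i) - 1))

instance factPrime (p : Nat.Primes) : Fact (p : ℕ).Prime := ⟨p.2⟩

/-- The local density `β_p`. -/
def localDensity {s r : ℕ} (f : Fin r → Fin s → ℤ)
    {K : Fin r → Type*} [∀ i, Field (K i)] [∀ i, NumberField (K i)]
    (ω : ∀ i, Module.Basis (Fin (Module.finrank ℚ (K i))) ℤ (𝓞 (K i)))
    (M : ℕ) (a : Fin s → ZMod M) (b : ∀ i, Fin (Module.finrank ℚ (K i)) → ZMod M)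
    (p : ℕ) [Fact p.Prime] : ℝ :=
  limUnder atTop (fun m : ℕ => localDensityApprox f ω M a b p m)

/-- `L = max {‖fᵢ‖, s, r, nᵢ |D_{Kᵢ}|}`, where `‖fᵢ‖` is the largest modulus of a coefficient
of `fᵢ`. -/
def size {s r : ℕ} (f : Fin r → Fin s → ℤ)
    (K : Fin r → Type*) [∀ i, Field (K i)] [∀ i, NumberField (K i)] : ℕ :=
  max (max s r) (Finset.univ.sup fun i : Fin r =>
    max (Finset.univ.sup fun j : Fin s => (f i j).natAbs)
      (Module.finrank ℚ (K i) * (NumberField.discr (K i)).natAbs))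

end NormFormSystem

end

/-! Let g_i(A) be the number of representations of A modulo p^m by the i-th norm form, divided by
p^(m(n_i - 1)). Up to the congruence conditions, β_p is the limit of the mean of ∏ g_i(f_i(u)).

Size of g (`exists_normCount_mul_le`). Multiplying A by the n-th power of a unit does not change the
count, and by Hensel's lemma every element congruent to 1 modulo p^W, W = 2 v_p(n) + 1, is such a
power. So the count is constant on A + (p^(k+W)), where k is the valuation of A, and it is bounded
by averaging over the x with p^k | N(x). The proportion of these x is at most (k+1)^n p^(-k)
(`card_aeval_normForm_eq_zero_le`): x and p^k generate a divisor of (p)^k of norm divisible by p^k,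
and (p) has at most n prime factors. Hence g(A) ≤ p^W (k+1)^n is polynomial in the valuation,
whereas p^e | f_i(u) has probability at most L p^(-e); all moments are finite.

Existence of the limit (`rho_succ`, `tendsto_localDensityApprox`). By the same invariance, densities
at valuations below k do not depend on m once m is large, so the means truncated at k are eventually
constant; the tail is O((3/4)^k) uniformly in m.

Large primes (`abs_sum_prod_one_add_sub_le`). If p > 2L² + L, then 𝓞_K / p is reduced, every residue
is a norm, and all units have the same count, so that g = 1 + O(1/p) on units. Each g_i(f_i(u)) has
mean exactly 1. In the expansion of ∏ (1 + h_i) the linear terms average to 0, and every other term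
contains h_i h_j with i ≠ j. Each h_i is O(1/p) unless p | f_i(u), an event of probability 1/p, and
two forms are independent because a 2 × 2 minor is a unit. The mean is therefore 1 + O(p^(-2)). The
remaining primes are absorbed in the constants. -/

noncomputable section

namespace NormFormSystem

/-! ### Functoriality, homogeneity and multiplicativity of the norm form. -/

section NormForm

variable {K : Type*} [Field K] [NumberField K] {n : ℕ} (ω : Module.Basis (Fin n) ℤ (𝓞 K))

/-- The values of the norm form as determinants, over any commutative ring. -/
theorem aeval_normForm {A : Type*} [CommRing A] (x : Fin n → A) :
    MvPolynomial.aeval x (normForm ω) =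
      (∑ j, x j • (Algebra.leftMulMatrix ω (ω j)).map (Int.castRingHom A)).det := by
  rw [normForm, AlgHom.map_det, map_sum]
  congr 2
  ext k i l
  simp [Matrix.map_apply]

theorem eval_normForm (X : Fin n → ℤ) :
    MvPolynomial.eval X (normForm ω) = Algebra.norm ℤ (∑ j, X j • ω j) := by
  rw [Algebra.norm_eq_matrix_det ω, normForm, RingHom.map_det, map_sum]
  congr 1
  ext k l
  simp [Matrix.sum_apply, -zsmul_eq_mul, -Int.cast_eq]

theorem aeval_normForm_map {A B : Type*} [CommRing A] [CommRing B] (φ : A →+* B)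
    (x : Fin n → A) :
    MvPolynomial.aeval (fun j => φ (x j)) (normForm ω) =
      φ (MvPolynomial.aeval x (normForm ω)) := by
  rw [MvPolynomial.map_aeval, MvPolynomial.aeval_def, MvPolynomial.coe_eval₂Hom]
  congr 1
  ext; simp

theorem aeval_normForm_intCast (q : ℕ) (X : Fin n → ℤ) :
    MvPolynomial.aeval (fun j => (X j : ZMod q)) (normForm ω) =
      ((Algebra.norm ℤ (∑ j, X j • ω j) : ℤ) : ZMod q) := by
  have := aeval_normForm_map ω (Int.castRingHom (ZMod q)) X
  rw [← eval_normForm]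
  simpa using this

/-- Homogeneity is what lets n-th powers of units act on the representation counts. -/
theorem aeval_normForm_smul {A : Type*} [CommRing A] (t : A) (x : Fin n → A) :
    MvPolynomial.aeval (t • x) (normForm ω) =
      t ^ n * MvPolynomial.aeval x (normForm ω) := by
  rw [aeval_normForm, aeval_normForm]
  have : ∑ j, (t • x) j • (Algebra.leftMulMatrix ω (ω j)).map (Int.castRingHom A) =
      t • ∑ j, x j • (Algebra.leftMulMatrix ω (ω j)).map (Int.castRingHom A) := by
    rw [Finset.smul_sum]
    exact Finset.sum_congr rfl fun j _ => by simp [mul_smul]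
  rw [this, Matrix.det_smul, Fintype.card_fin]

/-- Multiplication by an integer of the field whose norm is a unit modulo `q` permutes the
arguments of the norm form modulo `q`. -/
theorem exists_equiv_aeval_normForm_eq_mul {q : ℕ} (y : 𝓞 K)
    (hy : IsUnit ((Algebra.norm ℤ y : ℤ) : ZMod q)) :
    ∃ e : (Fin n → ZMod q) ≃ (Fin n → ZMod q), ∀ x,
      MvPolynomial.aeval (e x) (normForm ω) =
        ((Algebra.norm ℤ y : ℤ) : ZMod q) * MvPolynomial.aeval x (normForm ω) := by
  set Q := (Algebra.leftMulMatrix ω y).map (Int.castRingHom (ZMod q)) with hQ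
  have hdet : IsUnit Q.det := by
    rw [hQ, ← RingHom.mapMatrix_apply, ← RingHom.map_det, ← Algebra.norm_eq_matrix_det ω]
    exact hy
  have hu := (Matrix.isUnit_iff_isUnit_det Q).2 hdet
  have hbij : Function.Bijective Q.mulVec :=
    ⟨Matrix.mulVec_injective_of_isUnit hu, Matrix.mulVec_surjective_iff_isUnit.2 hu⟩
  refine ⟨Equiv.ofBijective Q.mulVec hbij, fun x => ?_⟩
  · change MvPolynomial.aeval (Q.mulVec x) (normForm ω) = _
    obtain ⟨X, rfl⟩ : ∃ X : Fin n → ℤ, x = fun j => (X j : ZMod q) :=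
      ⟨fun j => (ZMod.intCast_surjective (x j)).choose,
        funext fun j => (ZMod.intCast_surjective (x j)).choose_spec.symm⟩
    have h1 : Q.mulVec (fun j => (X j : ZMod q)) =
        fun j => (((Algebra.leftMulMatrix ω y).mulVec X j : ℤ) : ZMod q) := by
      ext i
      simp [hQ, Matrix.mulVec, dotProduct]
    -- The matrix of multiplication by y sends the coordinates of an integer of the field to those
    -- of its product with y; multiplicativity of the norm does the rest.
    have h2 : ∑ j, (Algebra.leftMulMatrix ω y).mulVec X j • ω j = y * ∑ j, X j • ω j := by
      have h3 := Algebra.leftMulMatrix_mulVec_repr ω y (∑ j, X j • ω j)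
      have h4 : ⇑(ω.repr (∑ j, X j • ω j)) = X := by
        rw [Module.Basis.repr_sum_self]
      rw [h4] at h3
      rw [h3, Module.Basis.sum_repr]
    rw [h1, aeval_normForm_intCast, aeval_normForm_intCast, h2, map_mul, Int.cast_mul]

end NormForm

/-! ### Surjectivity of the norm modulo primes not dividing the discriminant. -/

section ReductionModPrime

variable {K : Type*} [Field K] [NumberField K]

open TensorProduct

theorem leftMulMatrix_baseChange {S ι : Type*} [CommRing S] [Fintype ι] [DecidableEq ι]
    (b : Module.Basis ι ℤ S) (p : ℕ) (y : S) :
    Algebra.leftMulMatrix (Algebra.TensorProduct.basis (ZMod p) b)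
        ((1 : ZMod p) ⊗ₜ[ℤ] y) =
      (Algebra.leftMulMatrix b y).map (Int.castRingHom (ZMod p)) := by
  ext i j
  simp [Algebra.leftMulMatrix_eq_repr_mul]

theorem norm_baseChange (p : ℕ) (y : 𝓞 K) :
    Algebra.norm (ZMod p) ((1 : ZMod p) ⊗ₜ[ℤ] y) = ((Algebra.norm ℤ y : ℤ) : ZMod p) := by
  rw [Algebra.norm_eq_matrix_det (Algebra.TensorProduct.basis (ZMod p) (RingOfIntegers.basis K)),
    leftMulMatrix_baseChange, Algebra.norm_eq_matrix_det (RingOfIntegers.basis K),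
    ← RingHom.mapMatrix_apply, ← RingHom.map_det, eq_intCast]

theorem trace_baseChange (p : ℕ) (y : 𝓞 K) :
    Algebra.trace (ZMod p) (ZMod p ⊗[ℤ] 𝓞 K) ((1 : ZMod p) ⊗ₜ[ℤ] y) =
      ((Algebra.trace ℤ (𝓞 K) y : ℤ) : ZMod p) := by
  rw [Algebra.trace_eq_matrix_trace
      (Algebra.TensorProduct.basis (ZMod p) (RingOfIntegers.basis K)),
    leftMulMatrix_baseChange, Algebra.trace_eq_matrix_trace (RingOfIntegers.basis K)]
  simp [Matrix.trace]

theorem exists_one_tmul_eq {S : Type*} [CommRing S] (p : ℕ) (x : ZMod p ⊗[ℤ] S) :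
    ∃ y : S, x = (1 : ZMod p) ⊗ₜ[ℤ] y := by
  induction x using TensorProduct.induction_on with
  | zero => exact ⟨0, by simp⟩
  | tmul a y =>
    obtain ⟨a, rfl⟩ := ZMod.intCast_surjective a
    refine ⟨a • y, ?_⟩
    rw [TensorProduct.tmul_smul, TensorProduct.smul_tmul']
    simp
  | add x y hx hy =>
    obtain ⟨x, rfl⟩ := hx
    obtain ⟨y, rfl⟩ := hy
    exact ⟨x + y, by rw [TensorProduct.tmul_add]⟩

/-- The reduction of the ring of integers modulo a prime that does not divide the discriminant
is reduced. -/
theorem isReduced_baseChange (p : ℕ) [Fact p.Prime] (hp : ¬ (p : ℤ) ∣ discr K) :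
    IsReduced (ZMod p ⊗[ℤ] 𝓞 K) := by
  set b := RingOfIntegers.basis K
  set B := Algebra.TensorProduct.basis (ZMod p) b with hB
  have hdet : (Algebra.traceMatrix (ZMod p) B).det ≠ 0 := by
    have h1 : Algebra.traceMatrix (ZMod p) B =
        (Algebra.traceMatrix ℤ b).map (Int.castRingHom (ZMod p)) := by
      ext i j
      simp only [Algebra.traceMatrix_apply, Algebra.traceForm_apply, hB, Matrix.map_apply,
        Algebra.TensorProduct.basis_apply, Algebra.TensorProduct.tmul_mul_tmul, mul_one]
      rw [trace_baseChange]
      simp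
    rw [h1, ← RingHom.mapMatrix_apply, ← RingHom.map_det, ← Algebra.discr_def,
      ← NumberField.discr, eq_intCast]
    rwa [Ne, ZMod.intCast_zmod_eq_zero_iff_dvd]
  refine ⟨fun x hx => ?_⟩
  -- If x is nilpotent, so is each x * B i, and its trace vanishes. The coordinates of x are thus
  -- killed by the trace matrix, whose determinant is the discriminant modulo p.
  have h2 : (Algebra.traceMatrix (ZMod p) B).mulVec (B.equivFun x) = 0 := by
    ext i
    rw [Algebra.traceMatrix_of_basis_mulVec]
    simp only [Pi.zero_apply]
    have h3 : IsNilpotent (x * B i) := (Commute.all _ _).isNilpotent_mul_right hx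
    exact (Algebra.isNilpotent_trace_of_isNilpotent (R := ZMod p) h3).eq_zero
  have h4 := Matrix.eq_zero_of_mulVec_eq_zero hdet h2
  exact (LinearEquiv.map_eq_zero_iff _).1 h4

/-- In a finite-dimensional reduced algebra over a finite field, every element of the field is a
norm. -/
theorem norm_surjective_of_isReduced {F B : Type*} [Field F] [Finite F] [CommRing B]
    [Algebra F B] [Module.Finite F B] [Nontrivial B] [IsReduced B] (c : F) :
    ∃ x : B, Algebra.norm F x = c := by
  classical
  have : IsArtinianRing B := IsArtinianRing.of_finite F B
  obtain ⟨m, hm⟩ := Ideal.exists_maximal B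
  let I : MaximalSpectrum B := ⟨m, hm⟩
  let : Field (B ⧸ m) := Ideal.Quotient.field m
  have : Finite (B ⧸ m) := Module.finite_of_finite F
  obtain ⟨y, hy⟩ := FiniteField.norm_surjective F (B ⧸ m) c
  obtain ⟨y, rfl⟩ := Ideal.Quotient.mk_surjective y
  -- A reduced Artinian ring is the product of its residue fields. Let x be y in one factor and 1 in
  -- the others: multiplication by x is the identity on m and multiplication by y on B / m, so its
  -- determinant is the norm of y.
  set x : B := (IsArtinianRing.equivPi B).symm
    (fun J => Ideal.Quotient.mk J.asIdeal (if J = I then y else 1)) with hx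
  have hxe : ∀ J : MaximalSpectrum B, Ideal.Quotient.mk J.asIdeal x =
      Ideal.Quotient.mk J.asIdeal (if J = I then y else 1) := fun J =>
    congrFun ((IsArtinianRing.equivPi B).apply_symm_apply
      (fun J => Ideal.Quotient.mk J.asIdeal (if J = I then y else 1))) J
  have hmul : ∀ z ∈ m, x * z = z := fun z hz => by
    apply (IsArtinianRing.equivPi B).injective
    ext J
    change Ideal.Quotient.mk J.asIdeal (x * z) = Ideal.Quotient.mk J.asIdeal z
    rw [map_mul, hxe J]
    by_cases hJ : J = I
    · have : Ideal.Quotient.mk J.asIdeal z = 0 := by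
        rw [hJ]; exact Ideal.Quotient.eq_zero_iff_mem.2 hz
      rw [this, mul_zero]
    · rw [if_neg hJ, map_one, one_mul]
  refine ⟨x, ?_⟩
  have hle : m.restrictScalars F ≤ (m.restrictScalars F).comap (Algebra.lmul F B x) :=
    fun z hz => m.mul_mem_left x hz
  have h1 : (Algebra.lmul F B x).restrict hle = LinearMap.id := by
    ext z
    exact hmul z z.2
  have h2 : LinearMap.det ((m.restrictScalars F).mapQ (m.restrictScalars F)
      (Algebra.lmul F B x) hle) = Algebra.norm F (Ideal.Quotient.mk m y) := by
    rw [Algebra.norm_apply]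
    have hxy : Ideal.Quotient.mk m x = Ideal.Quotient.mk m y := by simpa [I] using hxe I
    rw [← hxy]
    have h3 : (m.restrictScalars F).mapQ (m.restrictScalars F) (Algebra.lmul F B x) hle =
        (show (B ⧸ m) →ₗ[F] (B ⧸ m) from Algebra.lmul F (B ⧸ m) (Ideal.Quotient.mk m x)) := by
      apply LinearMap.ext
      intro z
      obtain ⟨z, rfl⟩ := Submodule.Quotient.mk_surjective _ z
      rfl
    rw [h3]
    rfl
  rw [Algebra.norm_apply, LinearMap.det_eq_det_mul_det (m.restrictScalars F) _ hle, h1, h2, hy,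
    LinearMap.det_id, one_mul]

/-- Modulo a prime that does not divide the discriminant, every residue is a norm. -/
theorem exists_norm_modEq (p : ℕ) [Fact p.Prime] (hp : ¬ (p : ℤ) ∣ discr K) (c : ZMod p) :
    ∃ y : 𝓞 K, ((Algebra.norm ℤ y : ℤ) : ZMod p) = c := by
  have := isReduced_baseChange p hp
  have : Nontrivial (ZMod p ⊗[ℤ] 𝓞 K) := inferInstance
  obtain ⟨x, hx⟩ := norm_surjective_of_isReduced (F := ZMod p) (B := ZMod p ⊗[ℤ] 𝓞 K) c
  obtain ⟨y, rfl⟩ := exists_one_tmul_eq p x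
  exact ⟨y, by rw [← norm_baseChange, hx]⟩

end ReductionModPrime

/-! ### Zeros of the norm form modulo p^k, counted through ideals. -/

section IdealCount

/-- The number of divisors of `(P₁ ⋯ P_l) ^ k` is at most `(k + 1) ^ l`, for primes `Pᵢ`. -/
theorem exists_finset_of_dvd_prod_pow {R : Type*} [CommRing R] [IsDedekindDomain R] (k : ℕ)
    (s : Multiset (Ideal R)) (hs : ∀ P ∈ s, Prime P) :
    ∃ T : Finset (Ideal R), T.card ≤ (k + 1) ^ Multiset.card s ∧
      ∀ J, J ∣ s.prod ^ k → J ∈ T := by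
  classical
  induction s using Multiset.induction_on with
  | empty => exact ⟨{1}, by simp, fun J hJ => by
      rw [Multiset.prod_zero, one_pow] at hJ
      exact Finset.mem_singleton.2 (associated_iff_eq.1 (associated_one_iff_isUnit.2
        (isUnit_of_dvd_one hJ)))⟩
  | cons P s ih =>
    obtain ⟨T, hT, hJT⟩ := ih fun Q hQ => hs Q (Multiset.mem_cons_of_mem hQ)
    refine ⟨Finset.image₂ (fun i J => P ^ i * J) (Finset.range (k + 1)) T, ?_, fun J hJ => ?_⟩
    · refine (Finset.card_image₂_le _ _ _).trans ?_
      rw [Multiset.card_cons, pow_succ', Finset.card_range]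
      exact Nat.mul_le_mul_left _ hT
    · rw [Multiset.prod_cons, mul_pow] at hJ
      obtain ⟨J₁, J₂, h₁, h₂, rfl⟩ := exists_dvd_and_dvd_of_dvd_mul hJ
      obtain ⟨i, hi, hiJ⟩ := (dvd_prime_pow (hs P (Multiset.mem_cons_self P s)) k).1 h₁
      rw [associated_iff_eq] at hiJ
      exact Finset.mem_image₂.2 ⟨i, by simpa [Nat.lt_succ_iff] using hi, J₂, hJT J₂ h₂, by rw [hiJ]⟩

variable {K : Type*} [Field K] [NumberField K]

/-- Each prime factor of (p) has norm divisible by p, and these norms multiply to p to the power of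
the degree. -/
theorem card_normalizedFactors_le (p : ℕ) [hp : Fact p.Prime] :
    Multiset.card (UniqueFactorizationMonoid.normalizedFactors
      (Ideal.span {(p : 𝓞 K)})) ≤ Module.finrank ℤ (𝓞 K) := by
  set I := Ideal.span {(p : 𝓞 K)} with hI
  have hI0 : I ≠ ⊥ := by
    rw [hI, Ne, Ideal.span_singleton_eq_bot]
    exact_mod_cast hp.out.ne_zero
  set s := UniqueFactorizationMonoid.normalizedFactors I with hs
  have key : ∀ P ∈ s, p ∣ Ideal.absNorm P := fun P hP => by
    have hdvd : Ideal.absNorm P ∣ p ^ Module.finrank ℤ (𝓞 K) := by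
      rw [← Ideal.absNorm_span_natCast]
      exact map_dvd _ (UniqueFactorizationMonoid.dvd_of_mem_normalizedFactors hP)
    obtain ⟨j, -, hj⟩ := (Nat.dvd_prime_pow hp.out).1 hdvd
    rw [hj]
    refine dvd_pow_self p ?_
    rintro rfl
    rw [pow_zero, Ideal.absNorm_eq_one_iff] at hj
    exact (UniqueFactorizationMonoid.prime_of_normalized_factor P hP).not_isUnit
      (Ideal.isUnit_iff.2 hj)
  have hprod : ∀ t : Multiset (Ideal (𝓞 K)), (∀ P ∈ t, p ∣ Ideal.absNorm P) →
      p ^ Multiset.card t ∣ Ideal.absNorm t.prod := fun t => by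
    induction t using Multiset.induction_on with
    | empty => simp
    | cons P t ih =>
      intro h
      rw [Multiset.card_cons, Multiset.prod_cons, map_mul, pow_succ']
      exact mul_dvd_mul (h P (Multiset.mem_cons_self P t))
        (ih fun Q hQ => h Q (Multiset.mem_cons_of_mem hQ))
  have h := hprod s key
  rw [associated_iff_eq.1 (UniqueFactorizationMonoid.prod_normalizedFactors hI0), hI,
    Ideal.absNorm_span_natCast] at h
  exact (Nat.pow_dvd_pow_iff_le_right hp.out.one_lt).1 h

/-- If `p ^ k` divides the norm of `x`, then it divides the norm of the ideal `(x, p ^ k)`. -/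
theorem pow_dvd_absNorm_span_sup (p k : ℕ) [hp : Fact p.Prime] (x : 𝓞 K)
    (hx : (p : ℤ) ^ k ∣ Algebra.norm ℤ x) :
    p ^ k ∣ Ideal.absNorm (Ideal.span {x} ⊔ Ideal.span {(p : 𝓞 K) ^ k}) := by
  set J := Ideal.span {x} ⊔ Ideal.span {(p : 𝓞 K) ^ k} with hJ
  have hpJ : Ideal.span {(p : 𝓞 K) ^ k} ≤ J := le_sup_right
  have hxJ : Ideal.span {x} ≤ J := le_sup_left
  have hdvd : Ideal.absNorm J ∣ (p ^ k) ^ Module.finrank ℤ (𝓞 K) := by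
    rw [← Ideal.absNorm_span_natCast]
    push_cast
    exact Ideal.absNorm_dvd_absNorm_of_le hpJ
  rw [← pow_mul] at hdvd
  obtain ⟨j, -, hj⟩ := (Nat.dvd_prime_pow hp.out).1 hdvd
  rcases le_or_gt k j with hkj | hjk
  · rw [hj]; exact pow_dvd_pow p hkj
  have hmem : (p : 𝓞 K) ^ j ∈ J := by
    have := Ideal.absNorm_mem J
    rw [hj] at this
    exact_mod_cast this
  obtain ⟨A, hA⟩ := Ideal.dvd_iff_le.2 hxJ
  -- When N(J) = p^j with j < k, the ideal J contains p^(k-1), so (p^k) = J · (p)B, while (x) = J ·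
  -- A. Cancelling J from their sum gives A + (p)B = 1: A is prime to p, and the p-part of N(x) lies
  -- in N(J).
  have hmem' : Ideal.span {(p : 𝓞 K) ^ (k - 1)} ≤ J := by
    rw [Ideal.span_singleton_le_iff_mem]
    exact J.pow_mem_of_pow_mem hmem (by omega)
  obtain ⟨B, hB⟩ := Ideal.dvd_iff_le.2 hmem'
  have hpk : Ideal.span {(p : 𝓞 K) ^ k} = J * (Ideal.span {(p : 𝓞 K)} * B) := by
    rw [mul_left_comm, ← hB, Ideal.span_singleton_mul_span_singleton, ← pow_succ',
      Nat.sub_add_cancel (by omega)]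
  have hJ0 : J ≠ ⊥ := by
    intro h
    rw [h, Ideal.absNorm_bot] at hj
    exact (pow_pos hp.out.pos j).ne hj
  have htop : A ⊔ Ideal.span {(p : 𝓞 K)} * B = ⊤ := by
    have h : J * (A ⊔ Ideal.span {(p : 𝓞 K)} * B) = J * 1 := by
      rw [Ideal.mul_sup, ← hA, ← hpk, mul_one]
    rw [← Ideal.one_eq_top]
    exact mul_left_cancel₀ hJ0 h
  have hcop : ¬ p ∣ Ideal.absNorm A := by
    intro h
    obtain ⟨P, hP, hPp, hPA⟩ := Ideal.exists_isMaximal_dvd_of_dvd_absNorm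
      (Nat.prime_iff_prime_int.1 hp.out) A (by exact_mod_cast h)
    have hpP : Ideal.span {(p : 𝓞 K)} ≤ P := by
      rw [Ideal.span_singleton_le_iff_mem]
      have : (p : ℤ) ∈ P.under ℤ := by
        rw [hPp]
        exact Ideal.mem_span_singleton_self _
      simpa using this
    exact hP.ne_top (top_le_iff.1 (htop ▸ sup_le (Ideal.le_of_dvd hPA)
      (Ideal.mul_le_left.trans hpP)))
  have hnorm : p ^ k ∣ Ideal.absNorm J * Ideal.absNorm A := by
    rw [← map_mul, ← hA, Ideal.absNorm_span_singleton]
    rw [← Int.natCast_dvd]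
    exact_mod_cast hx
  exact (Nat.Coprime.pow_left k ((Nat.Prime.coprime_iff_not_dvd hp.out).2 hcop)).dvd_of_dvd_mul_right
    hnorm

/-- A group killed by q is a ℤ/q-module, so linear combinations make sense for coefficients modulo
q. -/
theorem exists_addMonoidHom_zmod {V : Type*} [AddCommGroup V] {n : ℕ} (q : ℕ)
    (hV : ∀ x : V, q • x = 0) (w : Fin n → V) :
    ∃ π : (Fin n → ZMod q) →+ V,
      ∀ X : Fin n → ℤ, π (fun j => (X j : ZMod q)) = ∑ j, X j • w j := by
  let : Module (ZMod q) V := AddCommGroup.zmodModule hV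
  refine ⟨(Fintype.linearCombination (ZMod q) w).toAddMonoidHom, fun X => ?_⟩
  simp only [LinearMap.toAddMonoidHom_coe, Fintype.linearCombination_apply]
  exact Finset.sum_congr rfl fun j _ => Int.cast_smul_eq_zsmul _ _ _

variable {n : ℕ} (ω : Module.Basis (Fin n) ℤ (𝓞 K))

/-- The coordinate vectors modulo `q` of the elements of an ideal that contains `q`. -/
theorem card_mem_ideal_mul_absNorm (q : ℕ) [NeZero q] (J : Ideal (𝓞 K)) (hq : (q : 𝓞 K) ∈ J) :
    Nat.card {x : Fin n → ZMod q //
      ∃ X : Fin n → ℤ, x = (fun j => (X j : ZMod q)) ∧ ∑ j, X j • ω j ∈ J} *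
      Ideal.absNorm J = q ^ n := by
  obtain ⟨π, hπ⟩ := exists_addMonoidHom_zmod (V := 𝓞 K ⧸ J) q (fun x => by
    obtain ⟨x, rfl⟩ := Ideal.Quotient.mk_surjective x
    rw [← map_nsmul, Ideal.Quotient.eq_zero_iff_mem, nsmul_eq_mul]
    exact J.mul_mem_right _ hq) fun j => Ideal.Quotient.mk J (ω j)
  simp only [← map_zsmul, ← map_sum] at hπ
  have hsurj : Function.Surjective π := fun y => by
    obtain ⟨y, rfl⟩ := Ideal.Quotient.mk_surjective y
    exact ⟨_, by rw [hπ (fun j => ω.repr y j), Module.Basis.sum_repr]⟩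
  have hker : Nat.card {x : Fin n → ZMod q //
      ∃ X : Fin n → ℤ, x = (fun j => (X j : ZMod q)) ∧ ∑ j, X j • ω j ∈ J} =
      Nat.card π.ker := by
    refine Nat.card_congr (Equiv.subtypeEquivRight fun x => ?_)
    constructor
    · rintro ⟨X, rfl, hX⟩
      exact (hπ X).trans (Ideal.Quotient.eq_zero_iff_mem.2 hX)
    · intro hx
      obtain ⟨X, rfl⟩ : ∃ X : Fin n → ℤ, x = fun j => (X j : ZMod q) :=
        ⟨fun j => (ZMod.intCast_surjective (x j)).choose,
          funext fun j => (ZMod.intCast_surjective (x j)).choose_spec.symm⟩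
      exact ⟨X, rfl, Ideal.Quotient.eq_zero_iff_mem.1 ((hπ X).symm.trans hx)⟩
  have hcard := AddSubgroup.card_mul_index π.ker
  rw [AddSubgroup.index_ker, AddMonoidHom.range_eq_top.2 hsurj] at hcard
  rw [hker, Ideal.absNorm_apply, Submodule.cardQuot_apply]
  rw [AddSubgroup.card_top] at hcard
  rw [hcard]
  simp

/-- The number of zeros of the norm form modulo `p ^ k`. -/
theorem card_aeval_normForm_eq_zero_le (p k : ℕ) [hp : Fact p.Prime] :
    Nat.card {x : Fin n → ZMod (p ^ k) // MvPolynomial.aeval x (normForm ω) = 0} * p ^ k ≤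
      (k + 1) ^ n * (p ^ k) ^ n := by
  classical
  have hfin : Module.finrank ℤ (𝓞 K) = n := by
    rw [Module.finrank_eq_card_basis ω, Fintype.card_fin]
  set s := UniqueFactorizationMonoid.normalizedFactors (Ideal.span {(p : 𝓞 K)})
  obtain ⟨T, hT, hJT⟩ := exists_finset_of_dvd_prod_pow k s
    fun P hP => UniqueFactorizationMonoid.prime_of_normalized_factor P hP
  have hp0 : Ideal.span {(p : 𝓞 K)} ≠ ⊥ := by
    rw [Ne, Ideal.span_singleton_eq_bot]
    exact_mod_cast hp.out.ne_zero
  rw [associated_iff_eq.1 (UniqueFactorizationMonoid.prod_normalizedFactors hp0),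
    Ideal.span_singleton_pow] at hJT
  let V : Ideal (𝓞 K) → Finset (Fin n → ZMod (p ^ k)) := fun J => Finset.univ.filter fun x =>
    ∃ X : Fin n → ℤ, x = (fun j => (X j : ZMod (p ^ k))) ∧ ∑ j, X j • ω j ∈ J
  let T' := T.filter fun J => (p : 𝓞 K) ^ k ∈ J ∧ p ^ k ∣ Ideal.absNorm J
  have hV : ∀ J ∈ T', (V J).card * p ^ k ≤ (p ^ k) ^ n := fun J hJ => by
    obtain ⟨hpJ, hJ⟩ := (Finset.mem_filter.1 hJ).2
    have h := card_mem_ideal_mul_absNorm ω (p ^ k) J (by exact_mod_cast hpJ)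
    rw [Nat.card_eq_fintype_card, Fintype.card_subtype] at h
    rw [← h]
    refine Nat.mul_le_mul_left _ (Nat.le_of_dvd (Nat.pos_of_ne_zero fun h0 => ?_) hJ)
    rw [h0, mul_zero] at h
    exact (pow_pos (pow_pos hp.out.pos k) n).ne h
  -- A zero x lies in the ideal (x, p^k), which divides (p)^k and has norm divisible by p^k. There
  -- are at most (k+1)^n such ideals, and by `hV` each contains a proportion at most p^(-k) of the
  -- classes.
  have hsub : (Finset.univ.filter fun x : Fin n → ZMod (p ^ k) =>
      MvPolynomial.aeval x (normForm ω) = 0) ⊆ T'.biUnion V := fun x hx => by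
    obtain ⟨X, rfl⟩ : ∃ X : Fin n → ℤ, x = fun j => (X j : ZMod (p ^ k)) :=
      ⟨fun j => (ZMod.intCast_surjective (x j)).choose,
        funext fun j => (ZMod.intCast_surjective (x j)).choose_spec.symm⟩
    rw [Finset.mem_filter, aeval_normForm_intCast, ZMod.intCast_zmod_eq_zero_iff_dvd] at hx
    have hle : Ideal.span {(p : 𝓞 K) ^ k} ≤
        Ideal.span {∑ j, X j • ω j} ⊔ Ideal.span {(p : 𝓞 K) ^ k} := le_sup_right
    refine Finset.mem_biUnion.2 ⟨Ideal.span {∑ j, X j • ω j} ⊔ Ideal.span {(p : 𝓞 K) ^ k},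
      Finset.mem_filter.2 ⟨hJT _ (Ideal.dvd_iff_le.2 hle),
        hle (Ideal.mem_span_singleton_self _),
        pow_dvd_absNorm_span_sup p k _ (by exact_mod_cast hx.2)⟩,
      Finset.mem_filter.2 ⟨Finset.mem_univ _, X, rfl,
        (le_sup_left : Ideal.span {∑ j, X j • ω j} ≤ _) (Ideal.mem_span_singleton_self _)⟩⟩
  rw [Nat.card_eq_fintype_card, Fintype.card_subtype]
  calc _ ≤ (T'.biUnion V).card * p ^ k := Nat.mul_le_mul_right _ (Finset.card_le_card hsub)
    _ ≤ (∑ J ∈ T', (V J).card) * p ^ k := Nat.mul_le_mul_right _ Finset.card_biUnion_le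
    _ = ∑ J ∈ T', (V J).card * p ^ k := Finset.sum_mul _ _ _
    _ ≤ ∑ J ∈ T', (p ^ k) ^ n := Finset.sum_le_sum hV
    _ = T'.card * (p ^ k) ^ n := by rw [Finset.sum_const, smul_eq_mul]
    _ ≤ (k + 1) ^ n * (p ^ k) ^ n := by
      refine Nat.mul_le_mul_right _ ((Finset.card_filter_le _ _).trans (hT.trans ?_))
      exact Nat.pow_le_pow_right (Nat.succ_pos k) ((card_normalizedFactors_le p).trans hfin.le)

end IdealCount

/-! ### Hensel's lemma: n-th powers close to 1. -/

section PowerResidues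

/-- Every element of `ℤ/p^m` congruent to `1` modulo a high power of `p` is an `n`-th power of an
element congruent to `1` modulo `p ^ v`. -/
theorem exists_pow_eq_of_modEq_one (p : ℕ) [hp : Fact p.Prime] {n : ℕ} (hn : n ≠ 0) (v m : ℕ)
    (a : ℤ) (ha : (p : ℤ) ^ (2 * (padicValNat p n + v) + 1) ∣ a - 1) :
    ∃ t : ℤ, (p : ℤ) ^ v ∣ t - 1 ∧ (t : ZMod (p ^ m)) ^ n = a := by
  -- Extracting an (n p^v)-th root z rather than an n-th root makes F'(1) divisible by p^v. Hensel's
  -- root satisfies ‖z - 1‖ < ‖F'(1)‖, so z ≡ 1 mod p^v, and z^(p^v) is the n-th root sought. The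
  -- exponent 2 v_p(E) + 1 in `ha` is what ‖F(1)‖ < ‖F'(1)‖² requires.
  set E := n * p ^ v with hE
  set F : Polynomial ℤ_[p] := Polynomial.X ^ E - Polynomial.C (a : ℤ_[p]) with hF
  have hE0 : E ≠ 0 := mul_ne_zero hn (pow_ne_zero _ hp.out.ne_zero)
  have hval : padicValNat p E = padicValNat p n + v := by
    rw [hE, padicValNat.mul hn (pow_ne_zero _ hp.out.ne_zero), padicValNat.prime_pow]
  have hnormE : ‖(E : ℤ_[p])‖ = (p : ℝ) ^ (-(padicValNat p n + v : ℕ) : ℤ) := by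
    rw [← hval, PadicInt.norm_def, PadicInt.coe_natCast,
      Padic.norm_eq_zpow_neg_valuation (Nat.cast_ne_zero.2 hE0), Padic.valuation_natCast]
  have hd : Polynomial.aeval (1 : ℤ_[p]) F.derivative = (E : ℤ_[p]) := by
    simp [hF, Polynomial.derivative_X_pow]
  have h1 : Polynomial.aeval (1 : ℤ_[p]) F = ((1 - a : ℤ) : ℤ_[p]) := by simp [hF]
  have hp1 : (1 : ℝ) < p := by exact_mod_cast hp.out.one_lt
  have hlt : ‖Polynomial.aeval (1 : ℤ_[p]) F‖ <
      ‖Polynomial.aeval (1 : ℤ_[p]) F.derivative‖ ^ 2 := by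
    rw [hd, h1, hnormE]
    refine (PadicInt.norm_int_le_pow_iff_dvd.2 (by
      rw [← neg_sub, dvd_neg]; exact_mod_cast ha) :
        _ ≤ (p : ℝ) ^ (-(2 * (padicValNat p n + v) + 1 : ℕ) : ℤ)).trans_lt ?_
    rw [← zpow_natCast, ← zpow_mul]
    exact zpow_lt_zpow_right₀ hp1 (by push_cast; omega)
  obtain ⟨z, hz, hz1, -, -⟩ := hensels_lemma hlt
  have hzE : z ^ E = a := by simpa [hF, sub_eq_zero] using hz
  have hzv : PadicInt.toZModPow v z = 1 := by
    rw [← sub_eq_zero, ← map_one (PadicInt.toZModPow v), ← map_sub, ← RingHom.mem_ker,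
      PadicInt.ker_toZModPow, ← PadicInt.norm_le_pow_iff_mem_span_pow]
    rw [hd, hnormE] at hz1
    exact hz1.le.trans (zpow_le_zpow_right₀ hp1.le (by omega))
  -- An approximation modulo p^(m+v) serves both moduli p^m and p^v.
  obtain ⟨Z, hZ⟩ := ZMod.intCast_surjective (PadicInt.toZModPow (m + v) z)
  have hZj : ∀ j ≤ m + v, (Z : ZMod (p ^ j)) = PadicInt.toZModPow j z := fun j hj => by
    rw [← PadicInt.cast_toZModPow j (m + v) hj, ← hZ,
      ZMod.cast_intCast (pow_dvd_pow p hj)]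
  refine ⟨Z ^ p ^ v, ?_, ?_⟩
  · have h : (((Z ^ p ^ v - 1 : ℤ)) : ZMod (p ^ v)) = 0 := by
      push_cast
      rw [hZj v (by omega), hzv, one_pow, sub_self]
    rw [ZMod.intCast_zmod_eq_zero_iff_dvd] at h
    exact_mod_cast h
  · push_cast
    rw [← pow_mul, mul_comm, ← hE, hZj m (by omega), ← map_pow, hzE, map_intCast]

end PowerResidues

/-! ### Fibres of homomorphisms and averages over finite groups. -/

section FiniteGroups

variable {G H : Type*} [AddCommGroup G] [AddCommGroup H] [Fintype G]

/-- Fibres of homomorphisms are no larger than the kernel. -/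
theorem card_fiber_le_card_ker [DecidableEq H] (π : G →+ H) (y : H) :
    (Finset.univ.filter fun x => π x = y).card ≤ (Finset.univ.filter fun x => π x = 0).card := by
  rcases (Finset.univ.filter fun x => π x = y).eq_empty_or_nonempty with h | ⟨x₀, h₀⟩
  · simp [h]
  · rw [Finset.mem_filter] at h₀
    refine Finset.card_le_card_of_injOn (fun x => x - x₀) (fun x hx => ?_)
      fun x _ x' _ h => sub_left_injective h
    simp only [Finset.coe_filter, Finset.mem_univ, true_and, Set.mem_ofPred_eq] at hx ⊢
    rw [map_sub, hx, h₀.2, sub_self]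

theorem card_fiber_eq_card_ker [DecidableEq H] (π : G →+ H) (hπ : Function.Surjective π) (y : H) :
    (Finset.univ.filter fun x => π x = y).card = (Finset.univ.filter fun x => π x = 0).card := by
  obtain ⟨x₀, rfl⟩ := hπ y
  refine Finset.card_bij' (fun x _ => x - x₀) (fun x _ => x + x₀) ?_ ?_ ?_ ?_ <;>
    simp +contextual

/-- Averages do not change under composition with a surjective homomorphism. -/
theorem sum_comp_mul_card [Fintype H] (π : G →+ H) (hπ : Function.Surjective π) {R : Type*} [CommSemiring R]
    (F : H → R) :
    (∑ x, F (π x)) * Fintype.card H = (∑ y, F y) * Fintype.card G := by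
  classical
  have h1 : ∑ x, F (π x) = ((Finset.univ.filter fun x => π x = 0).card : R) * ∑ y, F y := by
    rw [← Finset.sum_fiberwise (s := Finset.univ) (g := π), Finset.mul_sum]
    refine Finset.sum_congr rfl fun y _ => ?_
    rw [Finset.sum_congr rfl fun x hx => by rw [(Finset.mem_filter.1 hx).2], Finset.sum_const,
      card_fiber_eq_card_ker π hπ, nsmul_eq_mul]
  have h2 : (Finset.univ.filter fun x => π x = 0).card * Fintype.card H = Fintype.card G := by
    have := Finset.card_eq_sum_card_fiberwise (f := π) (s := Finset.univ) (t := Finset.univ)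
      (by simp)
    rw [Finset.sum_congr rfl fun y _ => card_fiber_eq_card_ker π hπ y] at this
    rw [← Finset.card_univ (α := G), this]
    simp [mul_comm]
  rw [h1, ← h2]
  push_cast
  ring

/-- No value is hit more often than the kernel allows. With F constant along the coset, this bounds
a single representation count by an average. -/
theorem sum_comp_add_le [Fintype H] (π : G →+ H) (y₀ : H) (F : H → ℕ) [DecidableEq H] :
    ∑ x, F (y₀ + π x) ≤ (Finset.univ.filter fun x => π x = 0).card * ∑ y, F y := by
  rw [← Finset.sum_fiberwise (s := Finset.univ) (g := fun x => y₀ + π x), Finset.mul_sum]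
  refine Finset.sum_le_sum fun y _ => ?_
  rw [Finset.sum_congr rfl fun x hx => by rw [(Finset.mem_filter.1 hx).2], Finset.sum_const,
    smul_eq_mul]
  refine Nat.mul_le_mul_right _ ((Finset.card_le_card ?_).trans (card_fiber_le_card_ker π (y - y₀)))
  intro x hx
  rw [Finset.mem_filter] at hx ⊢
  exact ⟨hx.1, by rw [← hx.2, add_sub_cancel_left]⟩

end FiniteGroups

/-! ### Valuations and units in ℤ/p^m. -/

section PrimePowerResidues

variable (p : ℕ) [hp : Fact p.Prime]

theorem pow_dvd_val_iff {k m : ℕ} (h : k ≤ m) (A : ZMod (p ^ m)) :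
    p ^ k ∣ A.val ↔ ZMod.castHom (pow_dvd_pow p h) (ZMod (p ^ k)) A = 0 := by
  rw [ZMod.castHom_apply, ← ZMod.natCast_val, ZMod.natCast_eq_zero_iff]

theorem pow_dvd_val_pow_mul {k m : ℕ} (h : k ≤ m) (A : ZMod (p ^ m)) :
    p ^ k ∣ ((p : ZMod (p ^ m)) ^ k * A).val := by
  rw [pow_dvd_val_iff p h, map_mul, map_pow, map_natCast]
  rw [← Nat.cast_pow, ZMod.natCast_self, zero_mul]

theorem isUnit_iff_not_dvd_val {m : ℕ} (hm : m ≠ 0) (A : ZMod (p ^ m)) :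
    IsUnit A ↔ ¬ p ∣ A.val := by
  rw [← Nat.Prime.coprime_iff_not_dvd hp.out, ← ZMod.natCast_zmod_val A, ZMod.isUnit_iff_coprime,
    Nat.coprime_pow_right_iff (Nat.pos_of_ne_zero hm), Nat.coprime_comm, ZMod.natCast_zmod_val]

theorem exists_eq_pow_mul_isUnit {m : ℕ} (A : ZMod (p ^ m)) (hA : A ≠ 0) :
    ∃ k < m, ∃ u : ZMod (p ^ m), IsUnit u ∧ A = (p : ZMod (p ^ m)) ^ k * u := by
  have hv : A.val ≠ 0 := by simpa [ZMod.val_eq_zero] using hA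
  obtain ⟨k, c, hc, hk⟩ := Nat.exists_eq_pow_mul_and_not_dvd hv p hp.out.ne_one
  have hkm : k < m := by
    have h1 : p ^ k ≤ A.val := Nat.le_of_dvd (Nat.pos_of_ne_zero hv) (hk ▸ dvd_mul_right _ _)
    exact (Nat.pow_lt_pow_iff_right hp.out.one_lt).1 (h1.trans_lt (ZMod.val_lt A))
  refine ⟨k, hkm, c, ?_, ?_⟩
  · rw [ZMod.isUnit_iff_coprime]
    exact (((Nat.Prime.coprime_iff_not_dvd hp.out).2 hc).symm).pow_right m
  · rw [← Nat.cast_pow, ← Nat.cast_mul, ← hk, ZMod.natCast_zmod_val]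

theorem card_pow_mul_eq_zero_le (m k : ℕ) :
    (Finset.univ.filter fun c : ZMod (p ^ m) => (p : ZMod (p ^ m)) ^ k * c = 0).card ≤ p ^ k := by
  have := IsAddCyclic.card_nsmul_eq_zero_le (α := ZMod (p ^ m)) (n := p ^ k)
    (pow_pos hp.out.pos k)
  simpa [nsmul_eq_mul] using this

omit hp in
theorem castHom_pi_surjective {k m : ℕ} (h : k ≤ m) (n : ℕ) :
    Function.Surjective ((ZMod.castHom (pow_dvd_pow p h) (ZMod (p ^ k))).toAddMonoidHom.compLeft
      (Fin n)) := fun y =>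
  ⟨fun j => (ZMod.castHom_surjective (pow_dvd_pow p h) (y j)).choose,
    funext fun j => (ZMod.castHom_surjective (pow_dvd_pow p h) (y j)).choose_spec⟩

end PrimePowerResidues

/-! ### Representation counts modulo prime powers: invariance, bounds, stability. -/

section Counts

variable {K : Type*} [Field K] [NumberField K] {n : ℕ} (ω : Module.Basis (Fin n) ℤ (𝓞 K))

/-- The number of representations of `A` by the norm form modulo `q`. -/
def normCount (q : ℕ) [NeZero q] (A : ZMod q) : ℕ :=
  (Finset.univ.filter fun x : Fin n → ZMod q => MvPolynomial.aeval x (normForm ω) = A).card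

theorem rho_eq_card (q : ℕ) [NeZero q] (A : ZMod q) (d : ℕ) (b : Fin n → ZMod d)
    [DecidablePred fun x : Fin n → ZMod q => ∀ j, ((x j).cast : ZMod d) = b j] :
    rho ω q A d b = (Finset.univ.filter fun x : Fin n → ZMod q =>
      MvPolynomial.aeval x (normForm ω) = A ∧ ∀ j, ((x j).cast : ZMod d) = b j).card := by
  rw [rho, ← Set.ncard_coe_finset]
  simp

theorem rho_le_normCount (q : ℕ) [NeZero q] (A : ZMod q) (d : ℕ) (b : Fin n → ZMod d) :
    rho ω q A d b ≤ normCount ω q A := by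
  classical
  rw [rho_eq_card, normCount]
  exact Finset.card_le_card fun x hx => by
    rw [Finset.mem_filter] at hx ⊢
    exact ⟨hx.1, hx.2.1⟩

theorem rho_eq_normCount (q : ℕ) [NeZero q] (A : ZMod q) (d : ℕ) (b : Fin n → ZMod d)
    [Subsingleton (ZMod d)] : rho ω q A d b = normCount ω q A := by
  classical
  rw [rho_eq_card, normCount]
  congr 1
  ext x
  simp only [Finset.mem_filter, Finset.mem_univ, true_and, and_iff_left_iff_imp]
  exact fun _ j => Subsingleton.elim _ _

theorem sum_ite_card_filter_and {X Y : Type*} [Fintype X] [Fintype Y] [DecidableEq Y] (g : X → Y)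
    (P : Y → Prop) (Q : X → Prop) [DecidablePred P] [DecidablePred Q] :
    ∑ A, (if P A then (Finset.univ.filter fun x => g x = A ∧ Q x).card else 0) =
      (Finset.univ.filter fun x => P (g x) ∧ Q x).card := by
  rw [Finset.card_eq_sum_card_fiberwise (f := g) (t := Finset.univ) (by simp)]
  refine Finset.sum_congr rfl fun A _ => ?_
  rw [Finset.filter_filter]
  split_ifs with h
  · congr 1
    ext x
    simp only [Finset.mem_filter, Finset.mem_univ, true_and]
    exact ⟨fun hx => ⟨⟨hx.1 ▸ h, hx.2⟩, hx.1⟩, fun hx => ⟨hx.2, hx.1.2⟩⟩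
  · symm
    rw [Finset.card_eq_zero, Finset.filter_eq_empty_iff]
    rintro x - ⟨⟨h1, -⟩, rfl⟩
    exact h h1

theorem sum_normCount_filter (q : ℕ) [NeZero q] (P : ZMod q → Prop) [DecidablePred P] :
    ∑ A, (if P A then normCount ω q A else 0) =
      (Finset.univ.filter fun x : Fin n → ZMod q =>
        P (MvPolynomial.aeval x (normForm ω))).card := by
  simpa [normCount] using sum_ite_card_filter_and
    (fun x : Fin n → ZMod q => MvPolynomial.aeval x (normForm ω)) P fun _ => True

theorem sum_normCount (q : ℕ) [NeZero q] : ∑ A, normCount ω q A = q ^ n := by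
  have := sum_normCount_filter ω q (fun _ => True)
  simpa using this

/-- Scaling x by t multiplies the norm by t^n, and t ≡ 1 mod d preserves the congruence condition.
-/
theorem rho_pow_mul (q : ℕ) [NeZero q] (A : ZMod q) (d : ℕ) (hd : d ∣ q) (b : Fin n → ZMod d)
    (t : ZMod q) (ht : IsUnit t) (htd : ZMod.castHom hd (ZMod d) t = 1) :
    rho ω q (t ^ n * A) d b = rho ω q A d b := by
  classical
  obtain ⟨t, rfl⟩ := ht
  rw [rho_eq_card, rho_eq_card]
  symm
  refine Finset.card_bijective (fun x => (t : ZMod q) • x)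
    (MulAction.bijective (α := (ZMod q)ˣ) t) fun x => ?_
  simp only [Finset.mem_filter, Finset.mem_univ, true_and]
  rw [aeval_normForm_smul]
  refine and_congr ?_ (forall_congr' fun j => ?_)
  · exact ((t.isUnit.pow n).mul_right_inj).symm
  · rw [Pi.smul_apply, smul_eq_mul, ← ZMod.castHom_apply (h := hd), ← ZMod.castHom_apply (h := hd),
      map_mul, htd, one_mul]

theorem normCount_pow_mul (q : ℕ) [NeZero q] (A t : ZMod q) (ht : IsUnit t) :
    normCount ω q (t ^ n * A) = normCount ω q A := by
  rw [← rho_eq_normCount ω q A 1 (fun _ => 0), ← rho_eq_normCount ω q _ 1 (fun _ => 0)]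
  exact rho_pow_mul ω q A 1 (one_dvd q) _ t ht (Subsingleton.elim _ _)

theorem normCount_norm_mul (q : ℕ) [NeZero q] (A : ZMod q) (y : 𝓞 K)
    (hy : IsUnit ((Algebra.norm ℤ y : ℤ) : ZMod q)) :
    normCount ω q (((Algebra.norm ℤ y : ℤ) : ZMod q) * A) = normCount ω q A := by
  obtain ⟨e, he⟩ := exists_equiv_aeval_normForm_eq_mul ω y hy
  symm
  refine Finset.card_bijective e e.bijective fun x => ?_
  simp only [Finset.mem_filter, Finset.mem_univ, true_and, he]
  exact hy.mul_right_inj.symm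

variable (p : ℕ) [hp : Fact p.Prime]

/-- The number of arguments modulo `p ^ m` at which the norm form is divisible by `p ^ k`. -/
theorem card_pow_dvd_aeval_normForm_le {k m : ℕ} (h : k ≤ m) :
    (Finset.univ.filter fun x : Fin n → ZMod (p ^ m) =>
      p ^ k ∣ (MvPolynomial.aeval x (normForm ω)).val).card * p ^ k ≤
      (k + 1) ^ n * (p ^ m) ^ n := by
  classical
  set φ := ZMod.castHom (pow_dvd_pow p h) (ZMod (p ^ k))
  have h1 := sum_comp_mul_card _ (castHom_pi_surjective p h n)
    (fun x => if MvPolynomial.aeval x (normForm ω) = 0 then 1 else 0)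
  have h2 : ∀ x : Fin n → ZMod (p ^ m), MvPolynomial.aeval (φ.toAddMonoidHom.compLeft (Fin n) x)
      (normForm ω) = 0 ↔ p ^ k ∣ (MvPolynomial.aeval x (normForm ω)).val := fun x => by
    rw [pow_dvd_val_iff p h, ← aeval_normForm_map]
    rfl
  simp only [φ] at h2
  simp only [h2, Finset.sum_boole, Nat.cast_id] at h1
  have h3 := card_aeval_normForm_eq_zero_le ω p k
  rw [Nat.card_eq_fintype_card, Fintype.card_subtype] at h3
  simp only [Fintype.card_pi_const, ZMod.card] at h1
  refine le_of_mul_le_mul_right (a := (p ^ k) ^ n) ?_ (pow_pos (pow_pos hp.out.pos _) _)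
  calc _ = _ * (p ^ k) ^ n * p ^ k := by ring
    _ = _ := by rw [h1]
    _ = _ * p ^ k * (p ^ m) ^ n := by ring
    _ ≤ (k + 1) ^ n * (p ^ k) ^ n * (p ^ m) ^ n := Nat.mul_le_mul_right _ h3
    _ = _ := by ring

/-- Since u + p^W c = u (1 + p^W u⁻¹ c) for a unit u, this turns a p-adically small additive change
of A into multiplication by an n-th power. -/
theorem exists_pow_eq_one_add {n : ℕ} (hn : n ≠ 0) {v m : ℕ} (hv : v ≤ m) (c : ZMod (p ^ m)) :
    ∃ t : ZMod (p ^ m), IsUnit t ∧ ZMod.castHom (pow_dvd_pow p hv) (ZMod (p ^ v)) t = 1 ∧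
      t ^ n = 1 + (p : ZMod (p ^ m)) ^ (2 * (padicValNat p n + v) + 1) * c := by
  obtain ⟨C, rfl⟩ := ZMod.intCast_surjective c
  obtain ⟨t, htv, ht⟩ := exists_pow_eq_of_modEq_one p hn v m
    (1 + (p : ℤ) ^ (2 * (padicValNat p n + v) + 1) * C) (by simp)
  push_cast at ht
  refine ⟨t, ?_, ?_, ht⟩
  · rw [← isUnit_pow_iff hn, ht]
    refine IsNilpotent.isUnit_one_add ⟨m, ?_⟩
    rw [mul_pow, ← pow_mul, mul_comm _ m, pow_mul, ← Nat.cast_pow, ZMod.natCast_self,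
      zero_pow (by omega), zero_mul]
  · rw [map_intCast, ← sub_eq_zero, ← Int.cast_one, ← Int.cast_sub,
      ZMod.intCast_zmod_eq_zero_iff_dvd]
    exact_mod_cast htv

/-- Upper bound for the number of representations, for an arbitrary prime. -/
theorem exists_normCount_mul_le (hn : n ≠ 0) (m : ℕ) (A : ZMod (p ^ m)) :
    ∃ k ≤ m, p ^ k ∣ A.val ∧ normCount ω (p ^ m) A * p ^ m ≤
      p ^ (2 * padicValNat p n + 1) * (k + 1) ^ n * (p ^ m) ^ n := by
  classical
  rcases eq_or_ne A 0 with rfl | hA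
  · refine ⟨m, le_rfl, by simp, ?_⟩
    have h := card_pow_dvd_aeval_normForm_le ω p (le_refl m)
    have h0 : ∀ x : Fin n → ZMod (p ^ m), p ^ m ∣ (MvPolynomial.aeval x (normForm ω)).val ↔
        MvPolynomial.aeval x (normForm ω) = 0 := fun x => by
      rw [pow_dvd_val_iff p le_rfl, ZMod.castHom_self, RingHom.id_apply]
    simp only [h0] at h
    rw [mul_assoc]
    exact h.trans (Nat.le_mul_of_pos_left _ (pow_pos hp.out.pos _))
  obtain ⟨k, hk, u, hu, rfl⟩ := exists_eq_pow_mul_isUnit p A hA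
  refine ⟨k, hk.le, pow_dvd_val_pow_mul p hk.le u, ?_⟩
  set W := 2 * padicValNat p n + 1
  set A := (p : ZMod (p ^ m)) ^ k * u
  set F : ZMod (p ^ m) → ℕ := fun y => if p ^ k ∣ y.val then normCount ω (p ^ m) y else 0
  -- For A = p^k u the element A + p^(k+W) c is an n-th power times A. The count at A is thus an
  -- average over a coset of multiples of p^k. The kernel of multiplication by p^(k+W) costs
  -- p^(k+W), of which p^k is recovered from the rarity of p^k | N(x).
  have hF : ∀ c, F (A + AddMonoidHom.mulLeft ((p : ZMod (p ^ m)) ^ (k + W)) c) =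
      normCount ω (p ^ m) A := fun c => by
    obtain ⟨u, rfl⟩ := hu
    have h1 : A + AddMonoidHom.mulLeft ((p : ZMod (p ^ m)) ^ (k + W)) c =
        (p : ZMod (p ^ m)) ^ k * (u + (p : ZMod (p ^ m)) ^ W * c) := by
      rw [AddMonoidHom.coe_mulLeft]; ring
    obtain ⟨t, ht, -, htn⟩ := exists_pow_eq_one_add p hn (Nat.zero_le m) ((↑u⁻¹ : ZMod (p ^ m)) * c)
    have h2 : A + AddMonoidHom.mulLeft ((p : ZMod (p ^ m)) ^ (k + W)) c = t ^ n * A := by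
      rw [htn, h1, add_zero]
      simp only [A]
      linear_combination (-(p : ZMod (p ^ m)) ^ k * (p : ZMod (p ^ m)) ^ W * c) * u.mul_inv
    simp only [F]
    rw [if_pos (h1 ▸ pow_dvd_val_pow_mul p hk.le _), h2, normCount_pow_mul ω _ _ _ ht]
  have h := sum_comp_add_le (AddMonoidHom.mulLeft ((p : ZMod (p ^ m)) ^ (k + W))) A F
  rw [Finset.sum_congr rfl fun c _ => hF c, Finset.sum_const, Finset.card_univ, ZMod.card,
    smul_eq_mul, sum_normCount_filter ω (p ^ m) fun y => p ^ k ∣ y.val] at h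
  calc _ = p ^ m * normCount ω (p ^ m) A := mul_comm _ _
    _ ≤ _ := h
    _ ≤ p ^ (k + W) * _ := Nat.mul_le_mul_right _ (card_pow_mul_eq_zero_le p m (k + W))
    _ = p ^ W * (_ * p ^ k) := by rw [pow_add]; ring
    _ ≤ p ^ W * ((k + 1) ^ n * (p ^ m) ^ n) :=
      Nat.mul_le_mul_left _ (card_pow_dvd_aeval_normForm_le ω p hk.le)
    _ = _ := by ring

theorem card_isUnit_zmod (q : ℕ) [NeZero q] [DecidablePred fun c : ZMod q => IsUnit c] :
    (Finset.univ.filter fun c : ZMod q => IsUnit c).card = q.totient := by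
  rw [← ZMod.card_units_eq_totient, ← Finset.card_univ]
  refine (Finset.card_bij (fun (u : (ZMod q)ˣ) _ => (u : ZMod q)) ?_ ?_ ?_).symm
  · intro u _
    simp
  · intro u _ v _ h
    exact Units.ext h
  · rintro c hc
    obtain ⟨u, rfl⟩ := (Finset.mem_filter.1 hc).2
    exact ⟨u, Finset.mem_univ _, rfl⟩

/-- For all but finitely many primes every unit modulo `p ^ m` permutes the values of the norm
form. -/
theorem normCount_isUnit_mul (hn : ¬ p ∣ n) (hD : ¬ (p : ℤ) ∣ discr K) (m : ℕ)
    (c A : ZMod (p ^ m)) (hc : IsUnit c) :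
    normCount ω (p ^ m) (c * A) = normCount ω (p ^ m) A := by
  rcases Nat.eq_zero_or_pos m with rfl | hm
  · have : Subsingleton (ZMod (p ^ 0)) := by rw [pow_zero]; infer_instance
    rw [Subsingleton.elim (c * A) A]
  have hn0 : n ≠ 0 := by rintro rfl; exact hn (dvd_zero p)
  have hpm : p ∣ p ^ m := dvd_pow_self p hm.ne'
  -- The unit c agrees with a norm N modulo p, and c / N ≡ 1 mod p is an n-th power, the Hensel
  -- exponent being 1 when p ∤ n. Norms and n-th powers both preserve the counts.
  obtain ⟨y, hy⟩ := exists_norm_modEq p hD (ZMod.castHom hpm (ZMod p) c)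
  set N : ZMod (p ^ m) := ((Algebra.norm ℤ y : ℤ) : ZMod (p ^ m)) with hN
  have hNu : IsUnit N := by
    rw [isUnit_iff_not_dvd_val p hm.ne']
    rw [isUnit_iff_not_dvd_val p hm.ne'] at hc
    rw [← ZMod.natCast_eq_zero_iff, ZMod.natCast_val, ← ZMod.castHom_apply (h := hpm)] at hc ⊢
    rwa [hN, map_intCast, hy]
  obtain ⟨N', hN'⟩ := hNu
  have hval : p ∣ (c - N).val := by
    rw [← ZMod.natCast_eq_zero_iff, ZMod.natCast_val, ← ZMod.castHom_apply (h := hpm), map_sub,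
      hN, map_intCast, hy, sub_self]
  obtain ⟨e, he⟩ := hval
  have hce : c = N + p * e := by
    rw [← Nat.cast_mul, ← he, ZMod.natCast_zmod_val]; ring
  obtain ⟨t, ht, -, htn⟩ := exists_pow_eq_one_add p hn0 (Nat.zero_le m)
    ((↑N'⁻¹ : ZMod (p ^ m)) * e)
  rw [padicValNat.eq_zero_of_not_dvd hn] at htn
  have hct : c * A = t ^ n * (N * A) := by
    rw [htn, hce, ← hN']
    linear_combination (-(p : ZMod (p ^ m)) * e * A) * N'.mul_inv
  rw [hct, normCount_pow_mul ω _ _ _ ht, hN]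
  exact normCount_norm_mul ω _ _ y (by rw [← hN, ← hN']; exact N'.isUnit)

theorem pow_le_two_mul_totient (m : ℕ) : p ^ m ≤ 2 * (p ^ m).totient := by
  rcases Nat.eq_zero_or_pos m with rfl | hm
  · simp
  rw [Nat.totient_prime_pow hp.out hm]
  obtain ⟨k, rfl⟩ : ∃ k, m = k + 1 := ⟨m - 1, by omega⟩
  rw [Nat.add_sub_cancel, pow_succ, mul_left_comm]
  have := hp.out.two_le
  exact Nat.mul_le_mul_left _ (by omega)

/-- Upper bound for the number of representations, for all but finitely many primes. -/
theorem exists_normCount_mul_le_two (hn : ¬ p ∣ n) (hD : ¬ (p : ℤ) ∣ discr K) (m : ℕ)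
    (A : ZMod (p ^ m)) :
    ∃ k ≤ m, p ^ k ∣ A.val ∧ normCount ω (p ^ m) A * p ^ m ≤
      2 * (k + 1) ^ n * (p ^ m) ^ n := by
  classical
  rcases eq_or_ne A 0 with rfl | hA
  · refine ⟨m, le_rfl, by simp, ?_⟩
    have h := card_pow_dvd_aeval_normForm_le ω p (le_refl m)
    have h0 : ∀ x : Fin n → ZMod (p ^ m), p ^ m ∣ (MvPolynomial.aeval x (normForm ω)).val ↔
        MvPolynomial.aeval x (normForm ω) = 0 := fun x => by
      rw [pow_dvd_val_iff p le_rfl, ZMod.castHom_self, RingHom.id_apply]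
    simp only [h0] at h
    rw [mul_assoc]
    exact h.trans (Nat.le_mul_of_pos_left _ two_pos)
  obtain ⟨k, hk, u, hu, rfl⟩ := exists_eq_pow_mul_isUnit p A hA
  refine ⟨k, hk.le, pow_dvd_val_pow_mul p hk.le u, ?_⟩
  set P := (p : ZMod (p ^ m)) ^ k
  set F : ZMod (p ^ m) → ℕ := fun y => if p ^ k ∣ y.val then normCount ω (p ^ m) y else 0
  -- All p^k c with c a unit have the same count, and units fill at least half of ℤ/p^m: the factor
  -- p^W of the general bound becomes 2.
  have hF : ∀ c, IsUnit c → F (0 + AddMonoidHom.mulLeft P c) = normCount ω (p ^ m) (P * u) :=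
    fun c hc => by
    simp only [F]
    rw [zero_add, AddMonoidHom.coe_mulLeft, if_pos (pow_dvd_val_pow_mul p hk.le c), mul_comm,
      normCount_isUnit_mul ω p hn hD m _ _ hc, mul_comm,
      normCount_isUnit_mul ω p hn hD m _ _ hu]
  have h := sum_comp_add_le (AddMonoidHom.mulLeft P) 0 F
  have h1 : (p ^ m).totient * normCount ω (p ^ m) (P * u) ≤
      ∑ c, F (0 + AddMonoidHom.mulLeft P c) := by
    rw [← card_isUnit_zmod, ← smul_eq_mul, ← Finset.sum_const]
    rw [Finset.sum_congr rfl fun c hc => (hF c (Finset.mem_filter.1 hc).2).symm]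
    exact Finset.sum_le_sum_of_subset (Finset.filter_subset _ _)
  rw [sum_normCount_filter ω (p ^ m) fun y => p ^ k ∣ y.val] at h
  calc _ = p ^ m * normCount ω (p ^ m) (P * u) := mul_comm _ _
    _ ≤ 2 * (p ^ m).totient * normCount ω (p ^ m) (P * u) :=
      Nat.mul_le_mul_right _ (pow_le_two_mul_totient p m)
    _ = 2 * ((p ^ m).totient * normCount ω (p ^ m) (P * u)) := mul_assoc _ _ _
    _ ≤ 2 * (p ^ k * _) := Nat.mul_le_mul_left _ (h1.trans (h.trans
      (Nat.mul_le_mul_right _ (card_pow_mul_eq_zero_le p m k))))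
    _ = 2 * (_ * p ^ k) := by ring
    _ ≤ 2 * ((k + 1) ^ n * (p ^ m) ^ n) :=
      Nat.mul_le_mul_left _ (card_pow_dvd_aeval_normForm_le ω p hk.le)
    _ = _ := by ring

/-- The number of representations of a unit. -/
theorem totient_mul_normCount (hn : ¬ p ∣ n) (hD : ¬ (p : ℤ) ∣ discr K) (m : ℕ)
    (A : ZMod (p ^ m)) (hA : IsUnit A)
    [DecidablePred fun x : Fin n → ZMod (p ^ m) => IsUnit (MvPolynomial.aeval x (normForm ω))] :
    (p ^ m).totient * normCount ω (p ^ m) A =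
      (Finset.univ.filter fun x : Fin n → ZMod (p ^ m) =>
        IsUnit (MvPolynomial.aeval x (normForm ω))).card := by
  classical
  rw [← card_isUnit_zmod, ← smul_eq_mul, ← Finset.sum_const]
  have h := sum_normCount_filter ω (p ^ m) fun c => IsUnit c
  rw [← Finset.sum_filter] at h
  refine Eq.trans (Finset.sum_congr rfl fun c hc => ?_) (h.trans (by congr!))
  rw [← normCount_isUnit_mul ω p hn hD m c A (Finset.mem_filter.1 hc).2, mul_comm,
    normCount_isUnit_mul ω p hn hD m A c hA]

/-- Stability of the number of representations under passage from `p ^ m` to `p ^ (m + 1)`. -/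
theorem rho_succ (hn : n ≠ 0) {v k m : ℕ} (b : Fin n → ZMod (p ^ v))
    (hm : k + (2 * (padicValNat p n + v) + 1) ≤ m) (A : ZMod (p ^ (m + 1)))
    (hA : ¬ p ^ k ∣ A.val) :
    p * rho ω (p ^ (m + 1)) A (p ^ v) b =
      p ^ n * rho ω (p ^ m) (ZMod.castHom (pow_dvd_pow p (Nat.le_add_right m 1)) (ZMod (p ^ m)) A) (p ^ v) b := by
  classical
  set φ := ZMod.castHom (pow_dvd_pow p (Nat.le_add_right m 1)) (ZMod (p ^ m)) with hφ
  set W := 2 * (padicValNat p n + v) + 1 with hW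
  have hvm : v ≤ m := by omega
  have hvm' : v ≤ m + 1 := by omega
  -- Here A = p^j u with j < k, and B - A is a multiple of p^m, hence of p^(j+W) as m ≥ k + W. So B
  -- = t^n A with t ≡ 1 mod p^v.
  have hB : ∀ B, φ B = φ A → rho ω (p ^ (m + 1)) B (p ^ v) b = rho ω (p ^ (m + 1)) A (p ^ v) b :=
    fun B hB => by
    have hA0 : A ≠ 0 := by rintro rfl; simp at hA
    obtain ⟨j, hj, u, ⟨u, rfl⟩, rfl⟩ := exists_eq_pow_mul_isUnit p A hA0
    have hjk : j < k := by
      by_contra hkj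
      refine hA (dvd_trans (pow_dvd_pow p (not_lt.1 hkj)) (pow_dvd_val_pow_mul p hj.le _))
    obtain ⟨e, he⟩ : p ^ m ∣ (B - (p : ZMod (p ^ (m + 1))) ^ j * u).val := by
      rw [pow_dvd_val_iff p (Nat.le_add_right m 1), map_sub, ← hφ, hB, sub_self]
    have hBe : B = (p : ZMod (p ^ (m + 1))) ^ j * u + (p : ZMod (p ^ (m + 1))) ^ m * e := by
      rw [← Nat.cast_pow, ← Nat.cast_pow, ← Nat.cast_mul (p ^ m), ← he, ZMod.natCast_zmod_val]
      push_cast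
      ring
    obtain ⟨t, ht, htv, htn⟩ := exists_pow_eq_one_add p hn hvm'
      ((↑u⁻¹ : ZMod (p ^ (m + 1))) * (p : ZMod (p ^ (m + 1))) ^ (m - j - W) * e)
    have hBt : B = t ^ n * ((p : ZMod (p ^ (m + 1))) ^ j * u) := by
      have hpow : (p : ZMod (p ^ (m + 1))) ^ m = (p : ZMod (p ^ (m + 1))) ^ j *
          (p : ZMod (p ^ (m + 1))) ^ W * (p : ZMod (p ^ (m + 1))) ^ (m - j - W) := by
        rw [← pow_add, ← pow_add]; congr 1; omega
      rw [htn, hBe, hpow, ← hW]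
      linear_combination (-(p : ZMod (p ^ (m + 1))) ^ j * (p : ZMod (p ^ (m + 1))) ^ W *
        (p : ZMod (p ^ (m + 1))) ^ (m - j - W) * e) * u.mul_inv
    rw [hBt, rho_pow_mul ω _ _ _ (pow_dvd_pow p hvm') b t ht htv]
  -- Each solution modulo p^m lifts to p^n vectors; by `hB` these are shared equally among the p
  -- lifts of `φ A`.
  have h1 := sum_comp_mul_card (φ.toAddMonoidHom.compLeft (Fin n))
    (castHom_pi_surjective p (Nat.le_add_right m 1) n)
    (fun x => if MvPolynomial.aeval x (normForm ω) = φ A ∧ ∀ j, ((x j).cast : ZMod (p ^ v)) = b j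
      then 1 else 0)
  have hcast : ∀ x : Fin n → ZMod (p ^ (m + 1)),
      (MvPolynomial.aeval (φ.toAddMonoidHom.compLeft (Fin n) x) (normForm ω) = φ A ∧
        ∀ j, ((φ.toAddMonoidHom.compLeft (Fin n) x j).cast : ZMod (p ^ v)) = b j) ↔
      (φ (MvPolynomial.aeval x (normForm ω)) = φ A ∧ ∀ j, ((x j).cast : ZMod (p ^ v)) = b j) :=
    fun x => by
    refine and_congr ?_ (forall_congr' fun j => ?_)
    · rw [← aeval_normForm_map]
      rfl
    · have : ((φ (x j)).cast : ZMod (p ^ v)) = (x j).cast := by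
        rw [hφ, ← ZMod.castHom_apply (h := pow_dvd_pow p hvm),
          ← ZMod.castHom_apply (h := pow_dvd_pow p hvm'), ← RingHom.comp_apply,
          ZMod.castHom_comp]
      rw [← this]
      rfl
  simp only [hcast, Finset.sum_boole, Nat.cast_id, Fintype.card_pi_const, ZMod.card] at h1
  rw [← rho_eq_card, ← sum_ite_card_filter_and (fun x => MvPolynomial.aeval x (normForm ω))
    (fun B => φ B = φ A)] at h1
  have h2 : ∑ B, (if φ B = φ A then (Finset.univ.filter fun x : Fin n → ZMod (p ^ (m + 1)) =>
      MvPolynomial.aeval x (normForm ω) = B ∧ ∀ j, ((x j).cast : ZMod (p ^ v)) = b j).card else 0) =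
      (∑ B, if φ B = φ A then 1 else 0) * rho ω (p ^ (m + 1)) A (p ^ v) b := by
    rw [Finset.sum_mul]
    refine Finset.sum_congr rfl fun B _ => ?_
    split_ifs with h
    · rw [← rho_eq_card, hB B h, one_mul]
    · rw [zero_mul]
  have h3 := sum_comp_mul_card φ.toAddMonoidHom (ZMod.castHom_surjective (pow_dvd_pow p (Nat.le_add_right m 1)))
    (fun y => if y = φ A then 1 else 0)
  simp only [Finset.sum_ite_eq', Finset.mem_univ, if_true, ZMod.card, one_mul] at h3
  change (∑ B, if φ B = φ A then 1 else 0) * p ^ m = p ^ (m + 1) at h3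
  have h4 : (∑ B, if φ B = φ A then 1 else 0) = p := by
    refine Nat.eq_of_mul_eq_mul_right (pow_pos hp.out.pos m) (h3.trans ?_)
    rw [pow_succ, mul_comm]
  rw [h2, h4] at h1
  refine Nat.eq_of_mul_eq_mul_right (pow_pos (pow_pos hp.out.pos m) n) (h1.trans ?_)
  ring

end Counts

/-! ### Means of products of almost independent factors. -/

section Moments

theorem abs_prod_one_add_sub_one_le {ι : Type*} [DecidableEq ι] (s : Finset ι) (h : ι → ℝ) :
    |∏ i ∈ s, (1 + h i) - 1| ≤ ∑ i ∈ s, |h i| * ∏ l ∈ s, (1 + |h l|) := by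
  induction s using Finset.induction_on with
  | empty => simp
  | insert a s ha ih =>
    rw [Finset.prod_insert ha, Finset.sum_insert ha, Finset.prod_insert ha]
    set P := ∏ i ∈ s, (1 + h i)
    set Q := ∏ i ∈ s, (1 + |h i|)
    have hPQ : |P| ≤ Q := by
      rw [Finset.abs_prod]
      exact Finset.prod_le_prod (fun i _ => abs_nonneg _) fun i _ =>
        (abs_add_le _ _).trans (by rw [abs_one])
    have hQ : 0 ≤ Q := (abs_nonneg _).trans hPQ
    have h1 : ∑ i ∈ s, |h i| * ((1 + |h a|) * Q) = (1 + |h a|) * ∑ i ∈ s, |h i| * Q := by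
      rw [Finset.mul_sum]
      exact Finset.sum_congr rfl fun i _ => by ring
    have hS : 0 ≤ ∑ i ∈ s, |h i| * Q := (abs_nonneg _).trans ih
    have h2 : |(1 + h a) * P - 1| ≤ |P - 1| + |h a| * |P| := by
      rw [← abs_mul]
      refine le_trans (le_of_eq ?_) (abs_add_le _ _)
      ring_nf
    have h3 := mul_le_mul_of_nonneg_left hPQ (abs_nonneg (h a))
    rw [h1]
    nlinarith [mul_nonneg (abs_nonneg (h a)) hS, mul_nonneg (mul_nonneg (abs_nonneg (h a))
      (abs_nonneg (h a))) hQ]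

/-- Every remaining term of the expansion contains h i * h j with i ≠ j. The distinctness matters:
divisibility events are independent only for different forms. -/
theorem abs_prod_one_add_sub_le {ι : Type*} [DecidableEq ι] (s : Finset ι) (h : ι → ℝ) :
    |∏ i ∈ s, (1 + h i) - 1 - ∑ i ∈ s, h i| ≤
      ∑ i ∈ s, ∑ j ∈ s, if i = j then 0 else |h i| * |h j| * ∏ l ∈ s, (1 + |h l|) := by
  induction s using Finset.induction_on with
  | empty => simp
  | insert a s ha ih =>
    have h0 := abs_prod_one_add_sub_one_le s h
    rw [Finset.prod_insert ha, Finset.sum_insert ha]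
    simp_rw [Finset.sum_insert ha, Finset.prod_insert ha]
    set P := ∏ i ∈ s, (1 + h i)
    set Q := ∏ i ∈ s, (1 + |h i|)
    have hQ : 0 ≤ Q := Finset.prod_nonneg fun i _ => by positivity
    have hle : Q ≤ (1 + |h a|) * Q := by nlinarith [mul_nonneg (abs_nonneg (h a)) hQ]
    have h1 : |(1 + h a) * P - 1 - (h a + ∑ i ∈ s, h i)| ≤
        |P - 1 - ∑ i ∈ s, h i| + |h a| * |P - 1| := by
      rw [← abs_mul]
      refine le_trans (le_of_eq ?_) (abs_add_le _ _)
      ring_nf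
    have h2 : |h a| * |P - 1| ≤
        ∑ j ∈ s, if a = j then 0 else |h a| * |h j| * ((1 + |h a|) * Q) := by
      refine (mul_le_mul_of_nonneg_left h0 (abs_nonneg _)).trans ?_
      rw [Finset.mul_sum]
      refine Finset.sum_le_sum fun j hj => ?_
      rw [if_neg (show a ≠ j from fun h' => ha (h' ▸ hj)), mul_assoc]
      gcongr
    have h3 : (∑ i ∈ s, ∑ j ∈ s, if i = j then 0 else |h i| * |h j| * Q) ≤
        ∑ i ∈ s, ((if i = a then 0 else |h i| * |h a| * ((1 + |h a|) * Q)) +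
          ∑ j ∈ s, if i = j then 0 else |h i| * |h j| * ((1 + |h a|) * Q)) := by
      refine Finset.sum_le_sum fun i _ => ?_
      refine le_add_of_nonneg_of_le (by split_ifs <;> positivity) (Finset.sum_le_sum fun j _ => ?_)
      split_ifs
      · exact le_rfl
      · gcongr
    rw [if_pos True.intro, zero_add]
    linarith

/-- The series that controls the moments of the weights. -/
def momentSeries (B : ℝ) (L N : ℕ) : ℝ :=
  ∑' e : ℕ, (B * ((e : ℝ) + 1) ^ L) ^ N * (3 / 4) ^ e

theorem summable_momentSeries (B : ℝ) (L N : ℕ) :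
    Summable fun e : ℕ => (B * ((e : ℝ) + 1) ^ L) ^ N * (3 / 4) ^ e := by
  have h := summable_pow_mul_geometric_of_norm_lt_one (L * N) (r := (3 / 4 : ℝ))
    (by norm_num)
  have h' := ((summable_nat_add_iff 1).2 h).mul_left (B ^ N * (4 / 3))
  refine h'.congr fun e => ?_
  push_cast
  rw [mul_pow, ← pow_mul, pow_succ]
  ring

theorem sum_range_le_momentSeries {B : ℝ} (hB : 0 ≤ B) (L N m : ℕ) :
    ∑ e ∈ Finset.range m, (B * ((e : ℝ) + 1) ^ L) ^ N * (3 / 4) ^ e ≤ momentSeries B L N :=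
  (summable_momentSeries B L N).sum_le_tsum _ fun e _ => by positivity

theorem momentSeries_nonneg {B : ℝ} (hB : 0 ≤ B) (L N : ℕ) : 0 ≤ momentSeries B L N :=
  tsum_nonneg fun e => by positivity

open Classical in
/-- A product of weights is bounded by a sum of powers, expressed through the events `D l e`. -/
theorem mul_mul_prod_le_sum {r m L N : ℕ} {B : ℝ} (hB : 1 ≤ B) (hN : r + 2 ≤ N)
    (D : Fin r → ℕ → Prop) (W : Fin r → ℝ) (hW1 : ∀ l, 1 ≤ W l)
    (hW : ∀ l, ∃ k ≤ m, D l k ∧ W l ≤ B * ((k : ℝ) + 1) ^ L) (i j : Fin r) :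
    W i * W j * ∏ l, W l ≤ ∑ l, ∑ e ∈ Finset.range (m + 1),
      if D l e then (B * ((e : ℝ) + 1) ^ L) ^ N else 0 := by
  -- The largest weight replaces all r + 2 factors, so one event D l k remains and no joint
  -- information on many forms is needed.
  obtain ⟨l, -, hl⟩ := Finset.exists_max_image Finset.univ W ⟨i, Finset.mem_univ i⟩
  obtain ⟨k, hk, hD, hWk⟩ := hW l
  have h0 : ∀ l, 0 ≤ W l := fun l => zero_le_one.trans (hW1 l)
  have hprod : ∏ l, W l ≤ W l ^ r := by
    refine (Finset.prod_le_prod (fun l _ => h0 l) fun l' _ => hl l' (Finset.mem_univ _)).trans ?_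
    simp
  have hnn : ∀ (l : Fin r) (e : ℕ), 0 ≤ if D l e then (B * ((e : ℝ) + 1) ^ L) ^ N else 0 :=
    fun l e => by split_ifs <;> positivity
  calc W i * W j * ∏ l, W l ≤ W l * W l * W l ^ r := by
        gcongr
        · exact Finset.prod_nonneg fun l _ => h0 l
        · exact mul_nonneg (h0 l) (h0 l)
        · exact h0 j
        · exact h0 l
        · exact hl i (Finset.mem_univ i)
        · exact hl j (Finset.mem_univ j)
    _ = W l ^ (r + 2) := by ring
    _ ≤ W l ^ N := pow_le_pow_right₀ (hW1 l) hN
    _ ≤ (B * ((k : ℝ) + 1) ^ L) ^ N := pow_le_pow_left₀ (h0 l) hWk N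
    _ = if D l k then (B * ((k : ℝ) + 1) ^ L) ^ N else 0 := by rw [if_pos hD]
    _ ≤ ∑ e ∈ Finset.range (m + 1), if D l e then (B * ((e : ℝ) + 1) ^ L) ^ N else 0 :=
      Finset.single_le_sum (f := fun e => if D l e then (B * ((e : ℝ) + 1) ^ L) ^ N else 0)
        (fun e _ => hnn l e) (Finset.mem_range.2 (Nat.lt_succ_of_le hk))
    _ ≤ _ := Finset.single_le_sum
        (f := fun l => ∑ e ∈ Finset.range (m + 1), if D l e then (B * ((e : ℝ) + 1) ^ L) ^ N else 0)
        (fun l _ => Finset.sum_nonneg fun e _ => hnn l e) (Finset.mem_univ l)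

open Classical in
/-- The sum of a product of weights over an event. -/
theorem sum_mul_prod_le {U : Type*} [Fintype U] {r m L N : ℕ} {B c : ℝ} (hB : 1 ≤ B)
    (hN : r + 2 ≤ N) (D : Fin r → ℕ → U → Prop) (W : Fin r → U → ℝ) (hW1 : ∀ l u, 1 ≤ W l u)
    (hW : ∀ l u, ∃ k ≤ m, D l k u ∧ W l u ≤ B * ((k : ℝ) + 1) ^ L) (i j : Fin r)
    (a : U → ℝ) (ha : ∀ u, 0 ≤ a u)
    (hac : ∀ l, ∀ e ≤ m, ∑ u, a u * (if D l e u then 1 else 0) ≤ c * (3 / 4) ^ e) (hc : 0 ≤ c) :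
    ∑ u, a u * (W i u * W j u * ∏ l, W l u) ≤ r * (c * momentSeries B L N) := by
  calc _ ≤ ∑ u, a u * ∑ l, ∑ e ∈ Finset.range (m + 1),
        (if D l e u then (B * ((e : ℝ) + 1) ^ L) ^ N else 0) :=
        Finset.sum_le_sum fun u _ => mul_le_mul_of_nonneg_left
          (mul_mul_prod_le_sum hB hN (fun l e => D l e u) (fun l => W l u) (fun l => hW1 l u)
            (fun l => hW l u) i j) (ha u)
    _ = ∑ l, ∑ e ∈ Finset.range (m + 1), (B * ((e : ℝ) + 1) ^ L) ^ N *
          ∑ u, a u * (if D l e u then 1 else 0) := by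
        simp_rw [Finset.mul_sum]
        rw [Finset.sum_comm]
        refine Finset.sum_congr rfl fun l _ => ?_
        rw [Finset.sum_comm]
        refine Finset.sum_congr rfl fun e _ => Finset.sum_congr rfl fun u _ => ?_
        split_ifs <;> ring
    _ ≤ ∑ l : Fin r, ∑ e ∈ Finset.range (m + 1), (B * ((e : ℝ) + 1) ^ L) ^ N *
          (c * (3 / 4) ^ e) := by
        refine Finset.sum_le_sum fun l _ => Finset.sum_le_sum fun e he => ?_
        exact mul_le_mul_of_nonneg_left (hac l e (Nat.lt_succ_iff.1 (Finset.mem_range.1 he)))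
          (by positivity)
    _ = r * (c * ∑ e ∈ Finset.range (m + 1), (B * ((e : ℝ) + 1) ^ L) ^ N * (3 / 4) ^ e) := by
        rw [Finset.sum_const, Finset.card_univ, Fintype.card_fin, nsmul_eq_mul]
        congr 1
        rw [Finset.mul_sum]
        exact Finset.sum_congr rfl fun e _ => by ring
    _ ≤ _ := by
        gcongr
        exact sum_range_le_momentSeries (by linarith) L N (m + 1)

open Classical in
/-- Almost independent factors with mean one and small fluctuations have a product with mean
`1 + O(p⁻²)`. -/
theorem abs_sum_prod_one_add_sub_le {U : Type*} [Fintype U] {r m L N : ℕ} {B p Q : ℝ}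
    (hB : 1 ≤ B) (hN : r + 2 ≤ N) (hp : 2 ≤ p) (hQ0 : 0 ≤ Q) (hQ : (Fintype.card U : ℝ) = Q)
    (D : Fin r → ℕ → U → Prop) (h : Fin r → U → ℝ)
    (hmean : ∀ i, ∑ u, h i u = 0)
    (hW : ∀ l u, ∃ k ≤ m, D l k u ∧ 1 + |h l u| ≤ B * ((k : ℝ) + 1) ^ L)
    (hsmall : ∀ l u, ¬ D l 1 u → |h l u| ≤ B / p)
    (hm : 1 ≤ m)
    (hD1 : ∀ l, ∀ e ≤ m, (∑ u, if D l e u then (1 : ℝ) else 0) ≤ Q * (1 / p) ^ e)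
    (hD2 : ∀ i l, i ≠ l → ∀ e ≤ m,
      (∑ u, if D i 1 u ∧ D l e u then (1 : ℝ) else 0) ≤ Q * (1 / p) ^ (e + 1)) :
    |∑ u, ∏ i, (1 + h i u) - Q| ≤ Q * (8 * B ^ 2 * r ^ 3 * momentSeries B L N / p ^ 2) := by
  have hp0 : 0 < p := by linarith
  set q := 1 / p with hq
  have hq0 : 0 ≤ q := by positivity
  have hq2 : q ≤ 1 / 2 := one_div_le_one_div_of_le two_pos hp
  have hmono : ∀ (P R : U → Prop) [DecidablePred P] [DecidablePred R], (∀ u, P u → R u) →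
      (∑ u, if P u then (1 : ℝ) else 0) ≤ ∑ u, if R u then (1 : ℝ) else 0 := by
    intro P R _ _ hPR
    refine Finset.sum_le_sum fun u _ => ?_
    by_cases hP : P u
    · rw [if_pos hP, if_pos (hPR u hP)]
    · rw [if_neg hP]; split_ifs <;> norm_num
  -- The rate 3/4 exceeds 1/2 ≥ q, and since 2 · 3/4 ≥ 1, shifting the exponent by one costs only a
  -- factor 2.
  have hpow : ∀ e : ℕ, q ^ e ≤ (3 / 4) ^ e := fun e => pow_le_pow_left₀ hq0 (by linarith) e
  have hpow' : ∀ e : ℕ, q ^ e ≤ 2 * (3 / 4) ^ (e + 1) := fun e => by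
    rw [pow_succ]
    have : (0 : ℝ) ≤ (3 / 4) ^ e := by positivity
    linarith [hpow e]
  have single : ∀ i l, ∀ e ≤ m, (∑ u, if D i 1 u ∧ D l e u then (1 : ℝ) else 0) ≤
      Q * (q * (2 * (3 / 4) ^ e)) := fun i l e he => by
    rcases e with _ | e
    · refine (hmono (fun u => D i 1 u ∧ D l 0 u) (D i 1) fun u hu => hu.1).trans ((hD1 i 1 hm).trans ?_)
      rw [pow_one, pow_zero, mul_one]
      exact mul_le_mul_of_nonneg_left (by linarith) hQ0
    · refine (hmono (fun u => D i 1 u ∧ D l (e + 1) u) (D l (e + 1)) fun u hu => hu.2).trans ((hD1 l _ he).trans ?_)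
      rw [pow_succ']
      exact mul_le_mul_of_nonneg_left (mul_le_mul_of_nonneg_left (hpow' e) hq0) hQ0
  -- As i ≠ j, the index l differs from one of them, so pairwise bounds suffice for three events.
  have triple : ∀ i j, i ≠ j → ∀ l, ∀ e ≤ m,
      (∑ u, if (D i 1 u ∧ D j 1 u) ∧ D l e u then (1 : ℝ) else 0) ≤
      Q * (q * (q * (2 * (3 / 4) ^ e))) := fun i j hij l e he => by
    rcases e with _ | e
    · refine (hmono (fun u => (D i 1 u ∧ D j 1 u) ∧ D l 0 u) (fun u => D i 1 u ∧ D j 1 u)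
        fun u hu => hu.1).trans
        ((hD2 i j hij 1 hm).trans ?_)
      rw [pow_zero, mul_one]
      refine mul_le_mul_of_nonneg_left ?_ hQ0
      linarith [mul_nonneg hq0 hq0, show q ^ (1 + 1) = q * q by ring]
    · have : ∀ i', i' ≠ l → (∀ u, (D i 1 u ∧ D j 1 u) ∧ D l (e + 1) u → D i' 1 u) →
          (∑ u, if (D i 1 u ∧ D j 1 u) ∧ D l (e + 1) u then (1 : ℝ) else 0) ≤
          Q * (q * (q * (2 * (3 / 4) ^ (e + 1)))) := fun i' hi' hu' => by
        refine (hmono (fun u => (D i 1 u ∧ D j 1 u) ∧ D l (e + 1) u)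
          (fun u => D i' 1 u ∧ D l (e + 1) u) fun u hu => ⟨hu' u hu, hu.2⟩).trans
          ((hD2 i' l hi' _ he).trans ?_)
        rw [pow_succ', pow_succ']
        exact mul_le_mul_of_nonneg_left (mul_le_mul_of_nonneg_left
          (mul_le_mul_of_nonneg_left (hpow' e) hq0) hq0) hQ0
      by_cases hil : i = l
      · exact this j (fun h => hij (hil.trans h.symm)) fun u hu => hu.1.2
      · exact this i hil fun u hu => hu.1.1
  have last : ∀ l, ∀ e ≤ m, (∑ u, if D l e u then (1 : ℝ) else 0) ≤ Q * (2 * (3 / 4) ^ e) :=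
    fun l e he => (hD1 l e he).trans (mul_le_mul_of_nonneg_left
      ((hpow e).trans (by linarith [show (0 : ℝ) ≤ (3 / 4) ^ e by positivity])) hQ0)
  set W : Fin r → U → ℝ := fun l u => 1 + |h l u| with hWdef
  -- A fluctuation is of size q off D i 1 and otherwise occurs with probability q, so each of the
  -- two gains a factor q. Expanding the product gives four terms, each contributing 2 q² (3/4)^e:
  -- hence the 8 in `hpair`.
  set a : Fin r → Fin r → U → ℝ := fun i j u =>
    B ^ 2 * (((if D i 1 u then 1 else 0) + q) * ((if D j 1 u then 1 else 0) + q)) with ha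
  have hhW : ∀ i u, |h i u| ≤ B * ((if D i 1 u then 1 else 0) + q) * W i u := fun i u => by
    have h0 := abs_nonneg (h i u)
    by_cases hD : D i 1 u
    · rw [if_pos hD, hWdef]
      have h1 : (1 : ℝ) ≤ B * (1 + q) := by nlinarith
      calc |h i u| ≤ 1 * (1 + |h i u|) := by linarith
        _ ≤ _ := mul_le_mul_of_nonneg_right h1 (by linarith)
    · rw [if_neg hD, zero_add, hWdef]
      have h1 : |h i u| ≤ B * q := by rw [hq, mul_one_div]; exact hsmall i u hD
      have h2 : 0 ≤ B * q := by positivity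
      calc |h i u| ≤ B * q * 1 := by linarith
        _ ≤ _ := mul_le_mul_of_nonneg_left (by linarith) h2
  have ha0 : ∀ i j u, 0 ≤ a i j u := fun i j u => by
    simp only [ha]
    have : ∀ i, (0 : ℝ) ≤ (if D i 1 u then 1 else 0) + q := fun i => by split_ifs <;> linarith
    exact mul_nonneg (sq_nonneg B) (mul_nonneg (this i) (this j))
  have hpair : ∀ i j, i ≠ j → ∑ u, |h i u| * |h j u| * ∏ l, (1 + |h l u|) ≤
      r * (B ^ 2 * (Q * (q * (q * 8))) * momentSeries B L N) := fun i j hij => by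
    refine le_trans ?_ (sum_mul_prod_le hB hN D W (fun l u => by simp [hWdef]) hW i j (a i j)
      (ha0 i j) (fun l e he => ?_) (by positivity))
    · refine Finset.sum_le_sum fun u _ => ?_
      have hP : 0 ≤ ∏ l, W l u := Finset.prod_nonneg fun l _ => by simp only [hWdef]; positivity
      calc _ ≤ (B * ((if D i 1 u then 1 else 0) + q) * W i u) *
            (B * ((if D j 1 u then 1 else 0) + q) * W j u) * ∏ l, W l u :=
            mul_le_mul_of_nonneg_right (mul_le_mul (hhW i u) (hhW j u) (abs_nonneg _)
              ((abs_nonneg _).trans (hhW i u))) hP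
        _ = _ := by simp only [ha]; ring
    · have hexp : ∀ u, a i j u * (if D l e u then 1 else 0) = B ^ 2 *
          ((if (D i 1 u ∧ D j 1 u) ∧ D l e u then 1 else 0) +
            q * (if D i 1 u ∧ D l e u then 1 else 0) + q * (if D j 1 u ∧ D l e u then 1 else 0) +
            q * (q * if D l e u then 1 else 0)) := fun u => by
        simp only [ha]
        by_cases h1 : D i 1 u <;> by_cases h2 : D j 1 u <;> by_cases h3 : D l e u <;>
          simp only [h1, h2, h3, and_true, and_false, and_self, if_true, if_false] <;> ring
      simp_rw [hexp]
      rw [← Finset.mul_sum]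
      simp only [Finset.sum_add_distrib, ← Finset.mul_sum]
      rw [mul_assoc (B ^ 2)]
      refine mul_le_mul_of_nonneg_left ?_ (sq_nonneg B)
      have t1 := triple i j hij l e he
      have t2 := mul_le_mul_of_nonneg_left (single i l e he) hq0
      have t3 := mul_le_mul_of_nonneg_left (single j l e he) hq0
      have t4 := mul_le_mul_of_nonneg_left (mul_le_mul_of_nonneg_left (last l e he) hq0) hq0
      linarith
  have hdiff : ∑ u, ∏ i, (1 + h i u) - Q =
      ∑ u, (∏ i, (1 + h i u) - 1 - ∑ i, h i u) := by
    rw [Finset.sum_sub_distrib, Finset.sum_sub_distrib, Finset.sum_comm (f := fun u i => h i u)]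
    simp [hmean, hQ]
  rw [hdiff]
  calc _ ≤ ∑ u, |∏ i, (1 + h i u) - 1 - ∑ i, h i u| := Finset.abs_sum_le_sum_abs _ _
    _ ≤ ∑ u, ∑ i, ∑ j, (if i = j then 0 else |h i u| * |h j u| * ∏ l, (1 + |h l u|)) :=
      Finset.sum_le_sum fun u _ => abs_prod_one_add_sub_le Finset.univ fun i => h i u
    _ = ∑ i, ∑ j, ∑ u, (if i = j then 0 else |h i u| * |h j u| * ∏ l, (1 + |h l u|)) := by
      rw [Finset.sum_comm]
      exact Finset.sum_congr rfl fun i _ => Finset.sum_comm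
    _ ≤ ∑ i : Fin r, ∑ j : Fin r, r * (B ^ 2 * (Q * (q * (q * 8))) * momentSeries B L N) := by
      refine Finset.sum_le_sum fun i _ => Finset.sum_le_sum fun j _ => ?_
      by_cases hij : i = j
      · have := momentSeries_nonneg (zero_le_one.trans hB) L N
        simp only [if_pos hij, Finset.sum_const_zero]
        positivity
      · simp only [if_neg hij]
        exact hpair i j hij
    _ = _ := by
      simp only [Finset.sum_const, Finset.card_univ, Fintype.card_fin, nsmul_eq_mul]
      rw [hq]
      field_simp

end Moments

/-! ### Divisibility and independence of linear forms modulo p^m. -/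

section LinearForms

variable {s : ℕ}

/-- A linear form modulo `q` as a homomorphism. -/
def linFormHom (c : Fin s → ℤ) (q : ℕ) : (Fin s → ZMod q) →+ ZMod q where
  toFun := linForm c q
  map_zero' := by simp [linForm]
  map_add' u u' := by simp [linForm, mul_add, Finset.sum_add_distrib]

theorem linForm_single (c : Fin s → ℤ) (q : ℕ) (j : Fin s) (x : ZMod q) :
    linForm c q (Pi.single j x) = c j * x := by
  simp [linForm, Pi.single_apply]

theorem castHom_linForm (c : Fin s → ℤ) {q q' : ℕ} (h : q' ∣ q) (u : Fin s → ZMod q) :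
    ZMod.castHom h (ZMod q') (linForm c q u) =
      linForm c q' ((ZMod.castHom h (ZMod q')).toAddMonoidHom.compLeft (Fin s) u) := by
  simp only [linForm, map_sum, map_mul, map_intCast]
  rfl

variable (p : ℕ) [hp : Fact p.Prime]

/-- The number of zeros of a linear form modulo `p ^ e`. -/
theorem card_pow_dvd_linForm_mul_le (c : Fin s → ℤ) {e m L : ℕ} (h : e ≤ m) (j : Fin s)
    (hL : (Finset.univ.filter fun x : ZMod (p ^ e) => (c j : ZMod (p ^ e)) * x = 0).card ≤ L) :
    (Finset.univ.filter fun u : Fin s → ZMod (p ^ m) =>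
      p ^ e ∣ (linForm c (p ^ m) u).val).card * p ^ e ≤ L * (p ^ m) ^ s := by
  classical
  set φ := ZMod.castHom (pow_dvd_pow p h) (ZMod (p ^ e)) with hφ
  let π : (Fin s → ZMod (p ^ m)) →+ ZMod (p ^ e) := φ.toAddMonoidHom.comp (linFormHom c (p ^ m))
  let μ : ZMod (p ^ e) →+ ZMod (p ^ e) := AddMonoidHom.mulLeft (c j : ZMod (p ^ e))
  -- The image of the form contains all multiples of the coefficient c j, so it has at least p^e / L
  -- elements.
  have hle : μ.range ≤ π.range := by
    rintro _ ⟨x, rfl⟩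
    obtain ⟨y, rfl⟩ := ZMod.castHom_surjective (pow_dvd_pow p h) x
    refine ⟨Pi.single j y, ?_⟩
    change φ (linForm c (p ^ m) (Pi.single j y)) = (c j : ZMod (p ^ e)) * φ y
    rw [linForm_single, map_mul, map_intCast]
  have h1 := AddSubgroup.card_mul_index π.ker
  have h2 := AddSubgroup.card_mul_index μ.ker
  rw [AddSubgroup.index_ker] at h1 h2
  have h3 : Nat.card μ.range ≤ Nat.card π.range :=
    Nat.card_le_card_of_injective _ (AddSubgroup.inclusion_injective hle)
  have h4 : Nat.card μ.ker ≤ L := by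
    refine le_trans (le_of_eq ?_) hL
    rw [← Fintype.card_subtype, ← Nat.card_eq_fintype_card]
    rfl
  have h5 : Nat.card π.ker = (Finset.univ.filter fun u : Fin s → ZMod (p ^ m) =>
      p ^ e ∣ (linForm c (p ^ m) u).val).card := by
    rw [← Fintype.card_subtype, ← Nat.card_eq_fintype_card]
    exact Nat.card_congr (Equiv.subtypeEquivRight fun u => (pow_dvd_val_iff p h _).symm)
  simp only [Nat.card_eq_fintype_card (α := Fin s → ZMod (p ^ m)), Fintype.card_pi_const,
    ZMod.card, Nat.card_eq_fintype_card (α := ZMod (p ^ e))] at h1 h2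
  rw [← h5]
  calc _ = Nat.card π.ker * (Nat.card μ.ker * Nat.card μ.range) :=
        congrArg (Nat.card π.ker * ·) h2.symm
    _ ≤ Nat.card π.ker * (L * Nat.card π.range) :=
        Nat.mul_le_mul_left _ (Nat.mul_le_mul h4 h3)
    _ = L * (Nat.card π.ker * Nat.card π.range) := by ring
    _ = _ := congrArg (L * ·) h1

/-- In a cyclic group multiplication by a has a kernel of at most |a| elements, uniformly in p and e
and also when p | a. -/
theorem card_intCast_mul_eq_zero_le (e : ℕ) (a : ℤ) (ha : a ≠ 0) :
    (Finset.univ.filter fun x : ZMod (p ^ e) => (a : ZMod (p ^ e)) * x = 0).card ≤ a.natAbs := by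
  have := IsAddCyclic.card_nsmul_eq_zero_le (α := ZMod (p ^ e)) (n := a.natAbs)
    (Int.natAbs_pos.2 ha)
  refine le_trans (Finset.card_le_card fun x hx => ?_) this
  rw [Finset.mem_filter] at hx ⊢
  refine ⟨hx.1, ?_⟩
  rcases Int.natAbs_eq a with h | h
  · have hx2 := hx.2
    rw [h] at hx2
    simpa [nsmul_eq_mul] using hx2
  · have hx2 := hx.2
    rw [h] at hx2
    simpa [nsmul_eq_mul] using hx2

theorem isUnit_intCast_zmod_pow (m : ℕ) (a : ℤ) (ha : ¬ (p : ℤ) ∣ a) :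
    IsUnit (a : ZMod (p ^ m)) := by
  rw [ZMod.coe_int_isUnit_iff_isCoprime]
  push_cast
  exact ((Prime.coprime_iff_not_dvd (Nat.prime_iff_prime_int.1 hp.out)).2 ha).pow_left

theorem card_intCast_mul_eq_zero_le_one (e : ℕ) (a : ℤ) (ha : ¬ (p : ℤ) ∣ a) :
    (Finset.univ.filter fun x : ZMod (p ^ e) => (a : ZMod (p ^ e)) * x = 0).card ≤ 1 := by
  refine Finset.card_le_one.2 fun x hx y hy => ?_
  have hu := isUnit_intCast_zmod_pow p e a ha
  rw [hu.mul_right_eq_zero.1 (Finset.mem_filter.1 hx).2,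
    hu.mul_right_eq_zero.1 (Finset.mem_filter.1 hy).2]

theorem linFormHom_surjective (c : Fin s → ℤ) (m : ℕ) (j : Fin s) (hj : ¬ (p : ℤ) ∣ c j) :
    Function.Surjective (linFormHom c (p ^ m)) := fun y => by
  obtain ⟨v, hv⟩ := isUnit_intCast_zmod_pow p m _ hj
  refine ⟨Pi.single j (↑v⁻¹ * y), ?_⟩
  change linForm c (p ^ m) _ = y
  rw [linForm_single, ← hv, Units.mul_inv_cancel_left]

/-- Cramer's rule in the coordinates j and k, the minor being a unit. Surjectivity onto pairs makes
the two values uniform and independent. -/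
theorem linFormHom_prod_surjective (c c' : Fin s → ℤ) (m : ℕ) (j k : Fin s)
    (hjk : ¬ (p : ℤ) ∣ c j * c' k - c k * c' j) :
    Function.Surjective ((linFormHom c (p ^ m)).prod (linFormHom c' (p ^ m))) := by
  rintro ⟨y, y'⟩
  obtain ⟨v, hv⟩ := isUnit_intCast_zmod_pow p m _ hjk
  push_cast at hv
  have hv' := v.mul_inv
  rw [hv] at hv'
  refine ⟨Pi.single j (↑v⁻¹ * (y * c' k - y' * c k)) + Pi.single k (↑v⁻¹ * (y' * c j - y * c' j)),
    ?_⟩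
  rw [map_add]
  ext
  · change linForm c (p ^ m) _ + linForm c (p ^ m) _ = y
    rw [linForm_single, linForm_single]
    linear_combination y * hv'
  · change linForm c' (p ^ m) _ + linForm c' (p ^ m) _ = y'
    rw [linForm_single, linForm_single]
    linear_combination y' * hv'

theorem card_pow_dvd_val_mul {e m : ℕ} (h : e ≤ m) :
    (Finset.univ.filter fun y : ZMod (p ^ m) => p ^ e ∣ y.val).card * p ^ e = p ^ m := by
  classical
  have h1 := sum_comp_mul_card (ZMod.castHom (pow_dvd_pow p h) (ZMod (p ^ e))).toAddMonoidHom
    (ZMod.castHom_surjective (pow_dvd_pow p h)) (fun y => if y = 0 then 1 else 0)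
  simp only [Finset.sum_ite_eq', Finset.mem_univ, if_true, ZMod.card, one_mul, Nat.cast_id] at h1
  refine Eq.trans ?_ h1
  rw [Finset.card_filter]
  congr 1
  exact Finset.sum_congr rfl fun y _ => by
    congr 1
    exact propext (pow_dvd_val_iff p h y)

/-- Independence of two linear forms that are not proportional modulo `p`. -/
theorem card_pow_dvd_linForm_and_mul (c c' : Fin s → ℤ) {d e m : ℕ} (hd : d ≤ m) (he : e ≤ m)
    (j k : Fin s) (hjk : ¬ (p : ℤ) ∣ c j * c' k - c k * c' j) :
    (Finset.univ.filter fun u : Fin s → ZMod (p ^ m) =>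
      p ^ d ∣ (linForm c (p ^ m) u).val ∧ p ^ e ∣ (linForm c' (p ^ m) u).val).card *
        p ^ (d + e) = (p ^ m) ^ s := by
  classical
  have h1 := sum_comp_mul_card _ (linFormHom_prod_surjective p c c' m j k hjk)
    (fun y => if p ^ d ∣ y.1.val ∧ p ^ e ∣ y.2.val then 1 else 0)
  rw [← Finset.card_filter, ← Finset.card_filter, Fintype.card_prod, ZMod.card,
    Fintype.card_pi_const, ZMod.card, Nat.cast_id, Nat.cast_id] at h1
  have h2 : (Finset.univ.filter fun y : ZMod (p ^ m) × ZMod (p ^ m) =>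
      p ^ d ∣ y.1.val ∧ p ^ e ∣ y.2.val).card =
      (Finset.univ.filter fun y : ZMod (p ^ m) => p ^ d ∣ y.val).card *
        (Finset.univ.filter fun y : ZMod (p ^ m) => p ^ e ∣ y.val).card := by
    rw [← Finset.card_product, ← Finset.filter_product]
    rfl
  rw [h2] at h1
  have h3 := card_pow_dvd_val_mul p hd
  have h4 := card_pow_dvd_val_mul p he
  refine Nat.eq_of_mul_eq_mul_right (mul_pos (pow_pos hp.out.pos m) (pow_pos hp.out.pos m)) ?_
  calc _ = (Finset.univ.filter fun u : Fin s → ZMod (p ^ m) =>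
      p ^ d ∣ (linForm c (p ^ m) u).val ∧ p ^ e ∣ (linForm c' (p ^ m) u).val).card *
        (p ^ m * p ^ m) * p ^ (d + e) := by ring
    _ = _ * p ^ (d + e) := congrArg (· * p ^ (d + e)) h1
    _ = ((Finset.univ.filter fun y : ZMod (p ^ m) => p ^ d ∣ y.val).card * p ^ d) *
        ((Finset.univ.filter fun y : ZMod (p ^ m) => p ^ e ∣ y.val).card * p ^ e) *
          (p ^ m) ^ s := by rw [pow_add]; ring
    _ = p ^ m * p ^ m * (p ^ m) ^ s := by
      congr 1
      exact congrArg₂ (· * ·) h3 h4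
    _ = _ := mul_comm _ _

/-- If all minors vanish, then c' j • c = c j • c', a non-trivial relation as soon as c j ≠ 0. -/
theorem exists_minor_ne_zero (c c' : Fin s → ℤ) (h : LinearIndependent ℤ ![c, c']) :
    ∃ j k, c j * c' k - c k * c' j ≠ 0 := by
  by_contra! hcon
  rw [LinearIndependent.pair_iff] at h
  have hc : c ≠ 0 := by
    rintro rfl
    simpa using h 1 0 (by simp)
  obtain ⟨j, hj⟩ := Function.ne_iff.1 hc
  refine hj (neg_eq_zero.1 (h (c' j) (-c j) ?_).2)
  ext k
  simp only [Pi.add_apply, Pi.smul_apply, smul_eq_mul, Pi.zero_apply]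
  linarith [hcon j k]

end LinearForms

/-! ### Normalised representation densities. -/

section Densities

variable {K : Type*} [Field K] [NumberField K] {n : ℕ} (ω : Module.Basis (Fin n) ℤ (𝓞 K))
  (p : ℕ) [hp : Fact p.Prime]

/-- The normalised number of representations modulo `p ^ m`. -/
def normDensity (m : ℕ) (A : ZMod (p ^ m)) : ℝ :=
  (normCount ω (p ^ m) A : ℝ) / (p : ℝ) ^ (m * (n - 1))

theorem normDensity_nonneg (m : ℕ) (A : ZMod (p ^ m)) : 0 ≤ normDensity ω p m A := by
  unfold normDensity
  positivity

theorem normDensity_le_of_mul_le (hn : n ≠ 0) (m : ℕ) (A : ZMod (p ^ m)) (c : ℕ)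
    (h : normCount ω (p ^ m) A * p ^ m ≤ c * (p ^ m) ^ n) : normDensity ω p m A ≤ c := by
  have hp0 : (0 : ℝ) < p := by exact_mod_cast hp.out.pos
  rw [normDensity, div_le_iff₀ (by positivity)]
  refine le_of_mul_le_mul_right (a := (p : ℝ) ^ m) ?_ (by positivity)
  obtain ⟨k, rfl⟩ := Nat.exists_eq_succ_of_ne_zero hn
  rw [mul_assoc, ← pow_add]
  calc _ ≤ (c : ℝ) * ((p : ℝ) ^ m) ^ (k + 1) := by exact_mod_cast h
    _ = _ := by rw [← pow_mul]; congr 2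

theorem exists_normDensity_le (hn : n ≠ 0) (m : ℕ) (A : ZMod (p ^ m)) :
    ∃ k ≤ m, p ^ k ∣ A.val ∧
      normDensity ω p m A ≤ ((p ^ (2 * padicValNat p n + 1) * (k + 1) ^ n : ℕ) : ℝ) := by
  obtain ⟨k, hk, hd, h⟩ := exists_normCount_mul_le ω p hn m A
  exact ⟨k, hk, hd, normDensity_le_of_mul_le ω p hn m A _ h⟩

theorem exists_normDensity_le_two (hn : ¬ p ∣ n) (hD : ¬ (p : ℤ) ∣ discr K) (m : ℕ)
    (A : ZMod (p ^ m)) :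
    ∃ k ≤ m, p ^ k ∣ A.val ∧ normDensity ω p m A ≤ ((2 * (k + 1) ^ n : ℕ) : ℝ) := by
  obtain ⟨k, hk, hd, h⟩ := exists_normCount_mul_le_two ω p hn hD m A
  exact ⟨k, hk, hd, normDensity_le_of_mul_le ω p (by rintro rfl; exact hn (dvd_zero p)) m A _ h⟩

theorem sum_normDensity (hn : n ≠ 0) (m : ℕ) : ∑ A, normDensity ω p m A = (p : ℝ) ^ m := by
  have hp0 : (0 : ℝ) < p := by exact_mod_cast hp.out.pos
  simp only [normDensity]
  rw [← Finset.sum_div, ← Nat.cast_sum, sum_normCount, div_eq_iff (by positivity), ← pow_add]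
  obtain ⟨k, rfl⟩ := Nat.exists_eq_succ_of_ne_zero hn
  push_cast
  rw [← pow_mul]
  congr 1
  rw [Nat.mul_succ, add_comm]

/-- The count is the same at all units. With g the density at A and z ≤ 2^n the quantity p times the
proportion of x with p | N(x), counting all x gives z + (p - 1) g = p. Hence p (g - 1) = g - z with
0 ≤ g ≤ 2. -/
theorem abs_normDensity_sub_one_le (hn : ¬ p ∣ n) (hD : ¬ (p : ℤ) ∣ discr K) {m : ℕ} (hm : m ≠ 0)
    (A : ZMod (p ^ m)) (hA : ¬ p ∣ A.val) : |normDensity ω p m A - 1| ≤ 2 ^ n / p := by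
  classical
  have hn0 : n ≠ 0 := by rintro rfl; exact hn (dvd_zero p)
  have hp2 : (2 : ℝ) ≤ p := by exact_mod_cast hp.out.two_le
  have hp0 : (0 : ℝ) < p := by linarith
  have h1 := totient_mul_normCount ω p hn hD m A ((isUnit_iff_not_dvd_val p hm A).2 hA)
  have h2 := card_pow_dvd_aeval_normForm_le ω p (Nat.one_le_iff_ne_zero.2 hm)
  have h3 : (Finset.univ.filter fun x : Fin n → ZMod (p ^ m) =>
      p ^ 1 ∣ (MvPolynomial.aeval x (normForm ω)).val).card +
      (Finset.univ.filter fun x : Fin n → ZMod (p ^ m) =>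
        IsUnit (MvPolynomial.aeval x (normForm ω))).card = (p ^ m) ^ n := by
    simp only [isUnit_iff_not_dvd_val p hm, pow_one]
    rw [Finset.card_filter_add_card_filter_not]
    simp
  rw [← h1] at h3
  set Z := (Finset.univ.filter fun x : Fin n → ZMod (p ^ m) =>
      p ^ 1 ∣ (MvPolynomial.aeval x (normForm ω)).val).card
  set T : ℝ := (p : ℝ) ^ (m * (n - 1)) with hT
  have hT0 : 0 < T := by positivity
  obtain ⟨k, rfl⟩ := Nat.exists_eq_succ_of_ne_zero hm
  have hpow : (((p ^ (k + 1)) ^ n : ℕ) : ℝ) = T * p ^ k * p := by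
    obtain ⟨l, rfl⟩ := Nat.exists_eq_succ_of_ne_zero hn0
    push_cast
    rw [hT, ← pow_mul, mul_assoc, ← pow_succ, ← pow_add]
    congr 1
  have htot : (((p ^ (k + 1)).totient : ℕ) : ℝ) = p ^ k * (p - 1) := by
    rw [Nat.totient_prime_pow_succ hp.out]
    push_cast [hp.out.one_le]
    ring
  have hg : (normCount ω (p ^ (k + 1)) A : ℝ) = normDensity ω p (k + 1) A * T := by
    rw [normDensity, div_mul_cancel₀ _ hT0.ne']
  set g := normDensity ω p (k + 1) A
  have e1 : (Z : ℝ) + p ^ k * (p - 1) * (g * T) = T * p ^ k * p := by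
    rw [← hpow, ← htot, ← hg]
    exact_mod_cast h3
  have e2 : (Z : ℝ) * p ≤ 2 ^ n * (T * p ^ k * p) := by
    rw [← hpow]
    exact_mod_cast (by simpa using h2)
  have hpk : (0 : ℝ) < p ^ k := by positivity
  set z := (Z : ℝ) / (T * p ^ k) with hz
  have hz0 : 0 ≤ z := by positivity
  have hZ : (Z : ℝ) = z * (T * p ^ k) := by rw [hz, div_mul_cancel₀ _ (by positivity)]
  have e3 : z + (p - 1) * g = p := by
    have : (T * p ^ k) * (z + (p - 1) * g) = (T * p ^ k) * p := by rw [hZ] at e1; linarith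
    exact mul_left_cancel₀ (by positivity) this
  have e4 : z ≤ 2 ^ n := by
    have : (T * p ^ k * p) * z ≤ (T * p ^ k * p) * 2 ^ n := by rw [hZ] at e2; linarith
    exact le_of_mul_le_mul_left this (by positivity)
  have h2n : (2 : ℝ) ≤ 2 ^ n := by
    calc (2 : ℝ) = 2 ^ 1 := by norm_num
      _ ≤ _ := pow_le_pow_right₀ (by norm_num) (Nat.one_le_iff_ne_zero.2 hn0)
  have e5 : (p - 1) * (g - 1) = 1 - z := by linarith
  rw [abs_le, ← neg_div, div_le_iff₀ hp0, le_div_iff₀ hp0]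
  constructor <;> nlinarith

end Densities

/-! ### Quantities bounded by L. -/

section Size

variable {s r : ℕ} (f : Fin r → Fin s → ℤ) (K : Fin r → Type*) [∀ i, Field (K i)]
  [∀ i, NumberField (K i)]

theorem numForms_le_size : r ≤ size f K := (le_max_right _ _).trans (le_max_left _ _)

theorem max_le_size (i : Fin r) : max (Finset.univ.sup fun j : Fin s => (f i j).natAbs)
    (Module.finrank ℚ (K i) * (discr (K i)).natAbs) ≤ size f K :=
  (Finset.le_sup (f := fun i : Fin r => max (Finset.univ.sup fun j : Fin s => (f i j).natAbs)
    (Module.finrank ℚ (K i) * (discr (K i)).natAbs)) (Finset.mem_univ i)).trans (le_max_right _ _)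

theorem coeff_le_size (i : Fin r) (j : Fin s) : (f i j).natAbs ≤ size f K :=
  (Finset.le_sup (f := fun j : Fin s => (f i j).natAbs) (Finset.mem_univ j)).trans
    ((le_max_left _ _).trans (max_le_size f K i))

theorem finrank_le_size (i : Fin r) : Module.finrank ℚ (K i) ≤ size f K :=
  (Nat.le_mul_of_pos_right _ (Int.natAbs_pos.2 (discr_ne_zero (K i)))).trans
    ((le_max_right _ _).trans (max_le_size f K i))

theorem discr_le_size (i : Fin r) : (discr (K i)).natAbs ≤ size f K :=
  (Nat.le_mul_of_pos_left _ Module.finrank_pos).trans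
    ((le_max_right _ _).trans (max_le_size f K i))

end Size

/-! ### Moments of the densities along the linear forms. -/

section Moments

variable {s r : ℕ} (f : Fin r → Fin s → ℤ) {K : Fin r → Type*} [∀ i, Field (K i)]
  [∀ i, NumberField (K i)]
  (ω : ∀ i, Module.Basis (Fin (Module.finrank ℚ (K i))) ℤ (𝓞 (K i)))
  (p : ℕ) [hp : Fact p.Prime]

/-- The factor p^(2 v_p(n) + 1) is at most p L², because p^(v_p(n)) ≤ n ≤ L. -/
theorem exists_one_add_normDensity_le {B : ℝ} (hB : 1 + (p : ℝ) * (size f K : ℝ) ^ 2 ≤ B)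
    (i : Fin r) (m : ℕ) (A : ZMod (p ^ m)) :
    ∃ k ≤ m, p ^ k ∣ A.val ∧ 1 + normDensity (ω i) p m A ≤ B * ((k : ℝ) + 1) ^ size f K := by
  have hn : Module.finrank ℚ (K i) ≠ 0 := Module.finrank_pos.ne'
  obtain ⟨k, hk, hd, h⟩ := exists_normDensity_le (ω i) p hn m A
  refine ⟨k, hk, hd, ?_⟩
  set n := Module.finrank ℚ (K i)
  have hv : ((p ^ padicValNat p n : ℕ) : ℝ) ≤ size f K := by
    exact_mod_cast (Nat.le_of_dvd (Nat.pos_of_ne_zero hn) pow_padicValNat_dvd).trans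
      (finrank_le_size f K i)
  have h1 : (1 : ℝ) ≤ (k : ℝ) + 1 := by linarith [Nat.cast_nonneg (α := ℝ) k]
  have h2 : ((k : ℝ) + 1) ^ n ≤ ((k : ℝ) + 1) ^ size f K :=
    pow_le_pow_right₀ h1 (finrank_le_size f K i)
  have h3 : (1 : ℝ) ≤ ((k : ℝ) + 1) ^ size f K := one_le_pow₀ h1
  have h4 : ((p ^ (2 * padicValNat p n + 1) : ℕ) : ℝ) ≤ p * (size f K : ℝ) ^ 2 := by
    have : ((p ^ (2 * padicValNat p n + 1) : ℕ) : ℝ) =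
        p * ((p ^ padicValNat p n : ℕ) : ℝ) ^ 2 := by push_cast; ring
    rw [this]
    gcongr
  rw [Nat.cast_mul] at h
  push_cast at h h4
  calc _ ≤ 1 * ((k : ℝ) + 1) ^ size f K + p * (size f K : ℝ) ^ 2 * ((k : ℝ) + 1) ^ size f K := by
        refine add_le_add (by linarith) (h.trans ?_)
        gcongr
    _ = (1 + p * (size f K : ℝ) ^ 2) * ((k : ℝ) + 1) ^ size f K := by ring
    _ ≤ _ := by gcongr

theorem sum_pow_dvd_linForm_le (hf : ∀ i, f i ≠ 0) (i : Fin r) {e m : ℕ} (he : e ≤ m) :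
    (∑ u : Fin s → ZMod (p ^ m),
      if p ^ e ∣ (linForm (f i) (p ^ m) u).val then (1 : ℝ) else 0) ≤
      (p : ℝ) ^ (m * s) * (size f K * (1 / p) ^ e) := by
  have hp0 : (0 : ℝ) < p := by exact_mod_cast hp.out.pos
  obtain ⟨j, hj⟩ := Function.ne_iff.1 (hf i)
  have h := card_pow_dvd_linForm_mul_le p (f i) he j
    ((card_intCast_mul_eq_zero_le p e _ hj).trans (coeff_le_size f K i j))
  rw [Finset.sum_boole, one_div, inv_pow, ← div_eq_mul_inv, ← mul_div_assoc,
    le_div_iff₀ (by positivity), pow_mul]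
  rw [mul_comm (size f K)] at h
  exact_mod_cast h

/-- The contribution to the density of the arguments at which a linear form is divisible by a high
power of `p`. -/
theorem sum_prod_normDensity_le (hf : ∀ i, f i ≠ 0) {B : ℝ}
    (hB : 1 + (p : ℝ) * (size f K : ℝ) ^ 2 ≤ B) (i : Fin r) {k m : ℕ} (hk : k ≤ m) :
    (∑ u : Fin s → ZMod (p ^ m), (if p ^ k ∣ (linForm (f i) (p ^ m) u).val then (1 : ℝ) else 0) *
      ∏ l, normDensity (ω l) p m (linForm (f l) (p ^ m) u)) ≤
      (p : ℝ) ^ (m * s) * ((size f K : ℝ) ^ 2 * (3 / 4) ^ k *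
        momentSeries B (size f K) (size f K + 2)) := by
  classical
  have hp0 : (0 : ℝ) < p := by exact_mod_cast hp.out.pos
  have hp2 : (2 : ℝ) ≤ p := by exact_mod_cast hp.out.two_le
  have hB1 : 1 ≤ B := le_trans (by linarith [show 0 ≤ (p : ℝ) * (size f K : ℝ) ^ 2 by positivity]) hB
  set L := size f K
  have hnd := fun l (u : Fin s → ZMod (p ^ m)) =>
    normDensity_nonneg (ω l) p m (linForm (f l) (p ^ m) u)
  have h := sum_mul_prod_le (U := Fin s → ZMod (p ^ m)) (r := r) (m := m) (L := L) (N := L + 2)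
    (c := (p : ℝ) ^ (m * s) * (L * (3 / 4) ^ k)) hB1
    (Nat.add_le_add_right (numForms_le_size f K) 2)
    (fun l e u => p ^ e ∣ (linForm (f l) (p ^ m) u).val)
    (fun l u => 1 + normDensity (ω l) p m (linForm (f l) (p ^ m) u))
    (fun l u => by linarith [hnd l u])
    (fun l u => exists_one_add_normDensity_le f ω p hB l m _) i i
    (fun u => if p ^ k ∣ (linForm (f i) (p ^ m) u).val then (1 : ℝ) else 0)
    (fun u => by split_ifs <;> norm_num)
    (fun l e he => ?_) (by positivity)
  · have hT := momentSeries_nonneg (zero_le_one.trans hB1) L (L + 2)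
    have hr : (r : ℝ) ≤ L := by exact_mod_cast numForms_le_size f K
    calc _ ≤ _ := Finset.sum_le_sum fun u _ => mul_le_mul_of_nonneg_left ?_
          (by split_ifs <;> norm_num)
      _ ≤ _ := h
      _ ≤ L * ((p : ℝ) ^ (m * s) * (L * (3 / 4) ^ k) * momentSeries B L (L + 2)) := by gcongr
      _ = _ := by ring
    have hle : ∏ l, normDensity (ω l) p m (linForm (f l) (p ^ m) u) ≤
        ∏ l, (1 + normDensity (ω l) p m (linForm (f l) (p ^ m) u)) :=
      Finset.prod_le_prod (fun l _ => hnd l u) fun l _ => by linarith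
    have h0 := Finset.prod_nonneg fun l (_ : l ∈ Finset.univ) => hnd l u
    have h1 := hnd i u
    refine hle.trans (le_mul_of_one_le_left (h0.trans hle) ?_)
    nlinarith
  · have hle : ∀ j, k ≤ j → e ≤ j → (1 / (p : ℝ)) ^ j ≤ (3 / 4) ^ k * (3 / 4) ^ e :=
      fun j hkj hej => by
      -- Because 1/2 ≤ (3/4)², the factor p^(-max(k, e)) pays for both (3/4)^k and (3/4)^e, so no
      -- independence is needed even at small p.
      have hp1 : 1 / (p : ℝ) ≤ (3 / 4) * (3 / 4) := by
        rw [div_le_iff₀ hp0]; linarith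
      calc (1 / (p : ℝ)) ^ j ≤ ((3 / 4) * (3 / 4)) ^ j :=
            pow_le_pow_left₀ (by positivity) hp1 j
        _ = (3 / 4) ^ j * (3 / 4) ^ j := mul_pow _ _ _
        _ ≤ _ := mul_le_mul (pow_le_pow_of_le_one (by norm_num) (by norm_num) hkj)
          (pow_le_pow_of_le_one (by norm_num) (by norm_num) hej) (by positivity) (by positivity)
    have hfin : ∀ j, k ≤ j → e ≤ j → (p : ℝ) ^ (m * s) * (L * (1 / p) ^ j) ≤
        (p : ℝ) ^ (m * s) * (L * (3 / 4) ^ k) * (3 / 4) ^ e := fun j hkj hej => by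
      rw [mul_assoc, mul_assoc]
      have := hle j hkj hej
      gcongr
    rcases le_total k e with hke | hek
    · refine le_trans (Finset.sum_le_sum fun u _ => ?_)
        ((sum_pow_dvd_linForm_le (K := K) f p hf l he).trans (hfin e hke le_rfl))
      split_ifs <;> norm_num
    · refine le_trans (Finset.sum_le_sum fun u _ => ?_)
        ((sum_pow_dvd_linForm_le (K := K) f p hf i hk).trans (hfin k le_rfl hek))
      split_ifs <;> norm_num

/-- The mean value of the product of the densities is `1 + O(p⁻²)`. -/
theorem abs_sum_prod_normDensity_sub_le (hf : ∀ i, f i ≠ 0)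
    (hli : ∀ i j, i ≠ j → LinearIndependent ℤ ![f i, f j])
    (hpL : 2 * size f K ^ 2 + size f K < p) {m : ℕ} (hm : m ≠ 0) :
    |(∑ u : Fin s → ZMod (p ^ m), ∏ l, normDensity (ω l) p m (linForm (f l) (p ^ m) u)) -
      (p : ℝ) ^ (m * s)| ≤ (p : ℝ) ^ (m * s) * (8 * (4 * 2 ^ size f K) ^ 2 * (size f K : ℝ) ^ 3 *
        momentSeries (4 * 2 ^ size f K) (size f K) (size f K + 2) / p ^ 2) := by
  classical
  have hp0 : (0 : ℝ) < p := by exact_mod_cast hp.out.pos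
  have hp2 : (2 : ℝ) ≤ p := by exact_mod_cast hp.out.two_le
  set L := size f K with hL
  -- The factor 2^L covers the estimate at units, and 4 covers 1 + |g - 1| ≤ 2 + 2 (k+1)^n.
  set B : ℝ := 4 * 2 ^ L with hB
  have h2L : (1 : ℝ) ≤ 2 ^ L := one_le_pow₀ (by norm_num)
  have hB1 : 1 ≤ B := by linarith
  -- By `hpL`, p exceeds the degrees, discriminants and coefficients (at most L) and the 2 × 2
  -- minors (at most 2 L²).
  have hsmallInt : ∀ a : ℤ, a ≠ 0 → a.natAbs < p → ¬ (p : ℤ) ∣ a := fun a ha hap hd =>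
    absurd (Nat.le_of_dvd (Int.natAbs_pos.2 ha) (Int.natCast_dvd.1 hd)) (not_le.2 hap)
  have hD : ∀ i, ¬ (p : ℤ) ∣ discr (K i) := fun i =>
    hsmallInt _ (discr_ne_zero _) (by have := discr_le_size f K i; omega)
  have hn : ∀ i, ¬ p ∣ Module.finrank ℚ (K i) := fun i hd => by
    have h1 := Nat.le_of_dvd Module.finrank_pos hd
    have := finrank_le_size f K i
    omega
  have hcoef : ∀ i, ∃ j, ¬ (p : ℤ) ∣ f i j := fun i => by
    obtain ⟨j, hj⟩ := Function.ne_iff.1 (hf i)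
    exact ⟨j, hsmallInt _ hj (by have := coeff_le_size f K i j; omega)⟩
  have hminor : ∀ i l, i ≠ l → ∃ j k, ¬ (p : ℤ) ∣ f i j * f l k - f i k * f l j :=
    fun i l hil => by
    obtain ⟨j, k, hjk⟩ := exists_minor_ne_zero _ _ (hli i l hil)
    refine ⟨j, k, hsmallInt _ hjk ?_⟩
    have h1 := Nat.mul_le_mul (coeff_le_size f K i j) (coeff_le_size f K l k)
    have h2 := Nat.mul_le_mul (coeff_le_size f K i k) (coeff_le_size f K l j)
    rw [← Int.natAbs_mul] at h1 h2
    have h3 := Int.natAbs_sub_le (f i j * f l k) (f i k * f l j)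
    rw [← hL] at h1 h2
    nlinarith
  have hcard : (Fintype.card (Fin s → ZMod (p ^ m)) : ℝ) = (p : ℝ) ^ (m * s) := by
    rw [Fintype.card_pi_const, ZMod.card, pow_mul]
    push_cast
    rfl
  have hT := momentSeries_nonneg (zero_le_one.trans hB1) L (L + 2)
  have hr : (r : ℝ) ≤ L := by exact_mod_cast numForms_le_size f K
  have h := abs_sum_prod_one_add_sub_le (U := Fin s → ZMod (p ^ m)) (r := r) (m := m) (L := L)
    (N := L + 2) (B := B) (p := p) (Q := (p : ℝ) ^ (m * s)) hB1
    (Nat.add_le_add_right (numForms_le_size f K) 2) hp2 (by positivity) hcard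
    (fun l e u => p ^ e ∣ (linForm (f l) (p ^ m) u).val)
    (fun l u => normDensity (ω l) p m (linForm (f l) (p ^ m) u) - 1)
    (fun i => ?_) (fun l u => ?_) (fun l u hlu => ?_) (Nat.one_le_iff_ne_zero.2 hm)
    (fun l e he => ?_) (fun i l hil e he => ?_)
  · simp only [add_sub_cancel] at h
    refine h.trans ?_
    gcongr
  · obtain ⟨j, hj⟩ := hcoef i
    have h1 := sum_comp_mul_card (linFormHom (f i) (p ^ m)) (linFormHom_surjective p (f i) m j hj)
      (fun A => normDensity (ω i) p m A)
    rw [sum_normDensity (ω i) p Module.finrank_pos.ne', hcard, ZMod.card] at h1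
    rw [Finset.sum_sub_distrib, sub_eq_zero, Finset.sum_const, Finset.card_univ, nsmul_eq_mul,
      mul_one, hcard]
    refine mul_right_cancel₀ (b := (p : ℝ) ^ m) (by positivity) ?_
    push_cast at h1
    rw [mul_comm ((p : ℝ) ^ (m * s))]
    exact h1
  · obtain ⟨k, hk, hd, hle⟩ := exists_normDensity_le_two (ω l) p (hn l) (hD l) m
      (linForm (f l) (p ^ m) u)
    refine ⟨k, hk, hd, ?_⟩
    have h0 := normDensity_nonneg (ω l) p m (linForm (f l) (p ^ m) u)
    have h1 : (1 : ℝ) ≤ (k : ℝ) + 1 := by linarith [Nat.cast_nonneg (α := ℝ) k]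
    have h2 := pow_le_pow_right₀ h1 (finrank_le_size f K l)
    have h3 : (1 : ℝ) ≤ ((k : ℝ) + 1) ^ L := one_le_pow₀ h1
    push_cast at hle
    have h4 : |normDensity (ω l) p m (linForm (f l) (p ^ m) u) - 1| ≤
        1 + normDensity (ω l) p m (linForm (f l) (p ^ m) u) :=
      abs_le.2 ⟨by linarith, by linarith⟩
    rw [hB]
    nlinarith
  · rw [pow_one] at hlu
    refine (abs_normDensity_sub_one_le (ω l) p (hn l) (hD l) hm _ hlu).trans ?_
    have := pow_le_pow_right₀ (one_le_two (α := ℝ)) (finrank_le_size f K l)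
    gcongr
    linarith
  · obtain ⟨j, hj⟩ := hcoef l
    have h1 := card_pow_dvd_linForm_mul_le p (f l) he j
      (card_intCast_mul_eq_zero_le_one p e _ hj)
    rw [one_mul] at h1
    have h2 : (∑ u : Fin s → ZMod (p ^ m),
        if p ^ e ∣ (linForm (f l) (p ^ m) u).val then (1 : ℝ) else 0) ≤
        (p : ℝ) ^ (m * s) * (1 / p) ^ e := by
      rw [Finset.sum_boole, one_div, inv_pow, ← div_eq_mul_inv, le_div_iff₀ (by positivity),
        pow_mul]
      exact_mod_cast h1
    convert h2
  · obtain ⟨j, k, hjk⟩ := hminor i l hil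
    have h1 := card_pow_dvd_linForm_and_mul p (f i) (f l) (Nat.one_le_iff_ne_zero.2 hm) he j k hjk
    have h2 : (∑ u : Fin s → ZMod (p ^ m), if p ^ 1 ∣ (linForm (f i) (p ^ m) u).val ∧
        p ^ e ∣ (linForm (f l) (p ^ m) u).val then (1 : ℝ) else 0) ≤
        (p : ℝ) ^ (m * s) * (1 / p) ^ (e + 1) := by
      rw [Finset.sum_boole, one_div, inv_pow, ← div_eq_mul_inv, le_div_iff₀ (by positivity),
        pow_mul, add_comm e 1]
      exact_mod_cast h1.le
    convert h2

end Moments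

/-! ### Truncation, existence of the limit, and estimates for β_p. -/

section Limit

variable {s r : ℕ} (f : Fin r → Fin s → ℤ) {K : Fin r → Type*} [∀ i, Field (K i)]
  [∀ i, NumberField (K i)]
  (ω : ∀ i, Module.Basis (Fin (Module.finrank ℚ (K i))) ℤ (𝓞 (K i)))
  (M : ℕ) (a : Fin s → ZMod M) (b : ∀ i, Fin (Module.finrank ℚ (K i)) → ZMod M)
  (p : ℕ) [hp : Fact p.Prime]

open Classical in
/-- The contribution of a single argument to the normalised count of solutions modulo `p ^ m`. -/
def localTerm (m : ℕ) (u : Fin s → ZMod (p ^ m)) : ℝ :=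
  if ∀ j, ((u j).cast : ZMod (p ^ padicValNat p M)) = (a j).cast then
    ∏ i, (rho (ω i) (p ^ m) (linForm (f i) (p ^ m) u) (p ^ padicValNat p M)
      (fun j => (b i j).cast) : ℝ) / (p : ℝ) ^ (m * (Module.finrank ℚ (K i) - 1))
  else 0

theorem localDensityApprox_eq (m : ℕ) :
    localDensityApprox f ω M a b p m =
      (1 / (p : ℝ) ^ (m * s)) * ∑ u, localTerm f ω M a b p m u := by
  classical
  unfold localDensityApprox localTerm
  rw [Finset.sum_filter]

omit hp in
theorem localTerm_nonneg (m : ℕ) (u : Fin s → ZMod (p ^ m)) : 0 ≤ localTerm f ω M a b p m u := by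
  unfold localTerm
  split_ifs
  · exact Finset.prod_nonneg fun i _ => by positivity
  · exact le_rfl

theorem localTerm_le (m : ℕ) (u : Fin s → ZMod (p ^ m)) :
    localTerm f ω M a b p m u ≤ ∏ i, normDensity (ω i) p m (linForm (f i) (p ^ m) u) := by
  unfold localTerm
  split_ifs
  · refine Finset.prod_le_prod (fun i _ => by positivity) fun i _ => ?_
    unfold normDensity
    have := rho_le_normCount (ω i) (p ^ m) (linForm (f i) (p ^ m) u) (p ^ padicValNat p M)
      (fun j => (b i j).cast)
    gcongr
  · exact Finset.prod_nonneg fun i _ => normDensity_nonneg _ _ _ _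

theorem localTerm_eq (hM : ¬ p ∣ M) (m : ℕ) (u : Fin s → ZMod (p ^ m)) :
    localTerm f ω M a b p m u = ∏ i, normDensity (ω i) p m (linForm (f i) (p ^ m) u) := by
  have hsub : Subsingleton (ZMod (p ^ padicValNat p M)) := by
    rw [padicValNat.eq_zero_of_not_dvd hM, pow_zero]
    infer_instance
  unfold localTerm
  rw [if_pos fun j => Subsingleton.elim _ _]
  exact Finset.prod_congr rfl fun i _ => by rw [normDensity, rho_eq_normCount]

open Classical in
/-- The contribution of an argument at which no linear form is divisible by `p ^ k`. -/
def truncatedTerm (k m : ℕ) (u : Fin s → ZMod (p ^ m)) : ℝ :=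
  if ∀ i, ¬ p ^ k ∣ (linForm (f i) (p ^ m) u).val then localTerm f ω M a b p m u else 0

/-- A discarded argument has some linear form divisible by p^k; this is the union bound over the
forms. -/
theorem abs_localTerm_sub_truncatedTerm_le (k m : ℕ) (u : Fin s → ZMod (p ^ m)) :
    |localTerm f ω M a b p m u - truncatedTerm f ω M a b p k m u| ≤
      ∑ i, (if p ^ k ∣ (linForm (f i) (p ^ m) u).val then (1 : ℝ) else 0) *
        ∏ l, normDensity (ω l) p m (linForm (f l) (p ^ m) u) := by
  have hnn : 0 ≤ ∏ l, normDensity (ω l) p m (linForm (f l) (p ^ m) u) :=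
    Finset.prod_nonneg fun l _ => normDensity_nonneg _ _ _ _
  have hterm : ∀ i, 0 ≤ (if p ^ k ∣ (linForm (f i) (p ^ m) u).val then (1 : ℝ) else 0) *
      ∏ l, normDensity (ω l) p m (linForm (f l) (p ^ m) u) := fun i =>
    mul_nonneg (by split_ifs <;> norm_num) hnn
  unfold truncatedTerm
  split_ifs with h
  · rw [sub_self, abs_zero]
    exact Finset.sum_nonneg fun i _ => hterm i
  · push Not at h
    obtain ⟨i, hi⟩ := h
    rw [sub_zero, abs_of_nonneg (localTerm_nonneg f ω M a b p m u)]
    refine (localTerm_le f ω M a b p m u).trans (le_trans (le_of_eq ?_)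
      (Finset.single_le_sum (fun i _ => hterm i) (Finset.mem_univ i)))
    rw [if_pos hi, one_mul]

/-- At valuations below k, `rho_succ` multiplies each count by p^(n-1), exactly the change in the
normalisation, and the conditions on u only involve its reduction modulo p^m. -/
theorem truncatedTerm_succ {k m : ℕ} (hv : padicValNat p M ≤ m) (hk : k ≤ m)
    (hm : ∀ i, k + (2 * (padicValNat p (Module.finrank ℚ (K i)) + padicValNat p M) + 1) ≤ m)
    (u : Fin s → ZMod (p ^ (m + 1))) :
    truncatedTerm f ω M a b p k (m + 1) u = truncatedTerm f ω M a b p k m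
      ((ZMod.castHom (pow_dvd_pow p (Nat.le_add_right m 1))
        (ZMod (p ^ m))).toAddMonoidHom.compLeft (Fin s) u) := by
  classical
  set φ := ZMod.castHom (pow_dvd_pow p (Nat.le_add_right m 1)) (ZMod (p ^ m)) with hφ
  have hp0 : (0 : ℝ) < p := by exact_mod_cast hp.out.pos
  have hlin : ∀ i, linForm (f i) (p ^ m) (φ.toAddMonoidHom.compLeft (Fin s) u) =
      φ (linForm (f i) (p ^ (m + 1)) u) := fun i => (castHom_linForm _ _ _).symm
  have hcast : ∀ e ≤ m, ∀ x : ZMod (p ^ (m + 1)),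
      ((φ x).cast : ZMod (p ^ e)) = (x.cast : ZMod (p ^ e)) := fun e he x => by
    rw [hφ, ← ZMod.castHom_apply (h := pow_dvd_pow p he),
      ← ZMod.castHom_apply (h := pow_dvd_pow p (he.trans (Nat.le_add_right m 1))),
      ← RingHom.comp_apply, ZMod.castHom_comp]
  have hdvd : ∀ i, p ^ k ∣ (φ (linForm (f i) (p ^ (m + 1)) u)).val ↔
      p ^ k ∣ (linForm (f i) (p ^ (m + 1)) u).val := fun i => by
    rw [pow_dvd_val_iff p hk, pow_dvd_val_iff p (hk.trans (Nat.le_add_right m 1)), hφ,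
      ← RingHom.comp_apply, ZMod.castHom_comp]
  unfold truncatedTerm
  simp only [hlin, hdvd]
  split_ifs with h
  swap
  · rfl
  unfold localTerm
  have hcong : (∀ j, ((φ.toAddMonoidHom.compLeft (Fin s) u j).cast : ZMod (p ^ padicValNat p M)) =
      (a j).cast) ↔ ∀ j, ((u j).cast : ZMod (p ^ padicValNat p M)) = (a j).cast :=
    forall_congr' fun j => by
      rw [← hcast _ hv]
      rfl
  simp only [hcong, hlin]
  split_ifs with h'
  swap
  · rfl
  refine Finset.prod_congr rfl fun i _ => ?_
  have hn : Module.finrank ℚ (K i) ≠ 0 := Module.finrank_pos.ne'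
  have h1 := rho_succ (ω i) p hn (fun j => ((b i j).cast : ZMod (p ^ padicValNat p M))) (hm i) _ (h i)
  rw [← hφ] at h1
  have h2 := congrArg (Nat.cast : ℕ → ℝ) h1
  have hpow : (p : ℝ) ^ Module.finrank ℚ (K i) = p ^ (Module.finrank ℚ (K i) - 1) * p :=
    (pow_sub_one_mul hn _).symm
  push_cast at h2
  rw [hpow] at h2
  rw [div_eq_div_iff (by positivity) (by positivity)]
  refine mul_left_cancel₀ hp0.ne' ?_
  rw [← mul_assoc, h2]
  ring

theorem mean_truncatedTerm_succ {k m : ℕ} (hv : padicValNat p M ≤ m) (hk : k ≤ m)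
    (hm : ∀ i, k + (2 * (padicValNat p (Module.finrank ℚ (K i)) + padicValNat p M) + 1) ≤ m) :
    (1 / (p : ℝ) ^ ((m + 1) * s)) * ∑ u, truncatedTerm f ω M a b p k (m + 1) u =
      (1 / (p : ℝ) ^ (m * s)) * ∑ u, truncatedTerm f ω M a b p k m u := by
  have hp0 : (0 : ℝ) < p := by exact_mod_cast hp.out.pos
  have h := sum_comp_mul_card _ (castHom_pi_surjective p (Nat.le_add_right m 1) s)
    (truncatedTerm f ω M a b p k m)
  simp only [← truncatedTerm_succ f ω M a b p hv hk hm, Fintype.card_pi_const, ZMod.card] at h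
  push_cast at h
  rw [one_div_mul_eq_div, one_div_mul_eq_div, div_eq_div_iff (by positivity) (by positivity),
    pow_mul, pow_mul]
  exact h

theorem abs_localDensityApprox_sub_le (hf : ∀ i, f i ≠ 0) {k m : ℕ} (hk : k ≤ m) :
    |localDensityApprox f ω M a b p m -
      (1 / (p : ℝ) ^ (m * s)) * ∑ u, truncatedTerm f ω M a b p k m u| ≤
      (size f K : ℝ) ^ 3 * momentSeries (1 + p * (size f K : ℝ) ^ 2) (size f K) (size f K + 2) *
        (3 / 4) ^ k := by
  have hp0 : (0 : ℝ) < p := by exact_mod_cast hp.out.pos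
  set L := size f K
  set T := momentSeries (1 + p * (L : ℝ) ^ 2) L (L + 2)
  have hT : 0 ≤ T := momentSeries_nonneg (by positivity) _ _
  have hr : (r : ℝ) ≤ L := by exact_mod_cast numForms_le_size f K
  rw [localDensityApprox_eq, ← mul_sub, ← Finset.sum_sub_distrib, abs_mul,
    abs_of_nonneg (by positivity), one_div_mul_eq_div, div_le_iff₀ (by positivity)]
  calc _ ≤ ∑ u, |localTerm f ω M a b p m u - truncatedTerm f ω M a b p k m u| :=
        Finset.abs_sum_le_sum_abs _ _
    _ ≤ _ := Finset.sum_le_sum fun u _ => abs_localTerm_sub_truncatedTerm_le f ω M a b p k m u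
    _ = _ := Finset.sum_comm
    _ ≤ ∑ i : Fin r, (p : ℝ) ^ (m * s) * ((L : ℝ) ^ 2 * (3 / 4) ^ k * T) :=
        Finset.sum_le_sum fun i _ => sum_prod_normDensity_le f ω p hf le_rfl i hk
    _ = r * ((p : ℝ) ^ (m * s) * ((L : ℝ) ^ 2 * (3 / 4) ^ k * T)) := by simp
    _ ≤ L * ((p : ℝ) ^ (m * s) * ((L : ℝ) ^ 2 * (3 / 4) ^ k * T)) := by gcongr
    _ = _ := by ring

/-- For fixed k the truncated means are constant in m from some N on, and the truncation error C
(3/4)^k is independent of m, so the sequence is Cauchy. -/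
theorem tendsto_localDensityApprox (hf : ∀ i, f i ≠ 0) :
    Tendsto (fun m : ℕ => localDensityApprox f ω M a b p m) atTop
      (𝓝 (localDensity f ω M a b p)) := by
  refine tendsto_nhds_limUnder (cauchySeq_tendsto_of_complete (Metric.cauchySeq_iff'.2 ?_))
  intro ε hε
  set C := (size f K : ℝ) ^ 3 *
    momentSeries (1 + p * (size f K : ℝ) ^ 2) (size f K) (size f K + 2)
  have hlim : Tendsto (fun k : ℕ => C * (3 / 4 : ℝ) ^ k) atTop (𝓝 0) := by
    simpa using (tendsto_pow_atTop_nhds_zero_of_lt_one (r := (3 / 4 : ℝ)) (by norm_num)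
      (by norm_num)).const_mul C
  obtain ⟨k, hk⟩ := (hlim.eventually_lt_const (half_pos hε)).exists
  set N := padicValNat p M + k +
    Finset.univ.sup fun i : Fin r =>
      k + (2 * (padicValNat p (Module.finrank ℚ (K i)) + padicValNat p M) + 1) with hN
  have hNi : ∀ i, k + (2 * (padicValNat p (Module.finrank ℚ (K i)) + padicValNat p M) + 1) ≤ N :=
    fun i => (Finset.le_sup (f := fun i : Fin r =>
      k + (2 * (padicValNat p (Module.finrank ℚ (K i)) + padicValNat p M) + 1))
      (Finset.mem_univ i)).trans (Nat.le_add_left _ _)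
  have hconst : ∀ m, N ≤ m → (1 / (p : ℝ) ^ (m * s)) * ∑ u, truncatedTerm f ω M a b p k m u =
      (1 / (p : ℝ) ^ (N * s)) * ∑ u, truncatedTerm f ω M a b p k N u := fun m hm => by
    induction m, hm using Nat.le_induction with
    | base => rfl
    | succ m hm ih =>
      rw [mean_truncatedTerm_succ f ω M a b p (by omega) (by omega) fun i => (hNi i).trans hm, ih]
  refine ⟨N, fun m hm => ?_⟩
  have h1 := abs_localDensityApprox_sub_le f ω M a b p hf (k := k) (m := m) (by omega)
  have h2 := abs_localDensityApprox_sub_le f ω M a b p hf (k := k) (m := N) (by omega)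
  rw [hconst m hm] at h1
  rw [abs_sub_comm] at h2
  rw [Real.dist_eq]
  refine (abs_sub_le _ _ _).trans_lt ((add_le_add h1 h2).trans_lt ?_)
  linarith

/-- A uniform bound for the local densities at the primes up to `X`. -/
def densityBound (L X : ℕ) : ℝ :=
  1 + (L : ℝ) ^ 2 * momentSeries (1 + X * (L : ℝ) ^ 2) L (L + 2)

theorem densityBound_nonneg (L X : ℕ) : 0 ≤ densityBound L X := by
  have := momentSeries_nonneg (B := 1 + X * (L : ℝ) ^ 2) (by positivity) L (L + 2)
  unfold densityBound
  positivity

theorem localDensityApprox_nonneg (m : ℕ) : 0 ≤ localDensityApprox f ω M a b p m := by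
  rw [localDensityApprox_eq]
  exact mul_nonneg (by positivity) (Finset.sum_nonneg fun u _ => localTerm_nonneg f ω M a b p m u)

theorem localDensityApprox_le (hf : ∀ i, f i ≠ 0) {X : ℕ} (hX : p ≤ X) (m : ℕ) :
    localDensityApprox f ω M a b p m ≤ densityBound (size f K) X := by
  have hp0 : (0 : ℝ) < p := by exact_mod_cast hp.out.pos
  have hT := momentSeries_nonneg (B := 1 + X * (size f K : ℝ) ^ 2) (by positivity) (size f K)
    (size f K + 2)
  rw [localDensityApprox_eq, one_div_mul_eq_div, div_le_iff₀ (by positivity)]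
  refine (Finset.sum_le_sum fun u _ => localTerm_le f ω M a b p m u).trans ?_
  unfold densityBound
  -- An empty product is bounded by the summand 1 of `densityBound`. For r > 0 the tail estimate is
  -- applied with k = 0, where its divisibility condition always holds.
  rcases Nat.eq_zero_or_pos r with rfl | hr
  · simp only [Finset.univ_eq_empty, Finset.prod_empty, Finset.sum_const, Finset.card_univ,
      Fintype.card_pi_const, ZMod.card, nsmul_eq_mul, mul_one]
    push_cast
    rw [← pow_mul]
    have h1 := mul_nonneg (sq_nonneg (size f K : ℝ)) hT
    refine le_mul_of_one_le_left (by positivity) ?_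
    linarith
  · have hpX : (p : ℝ) ≤ X := by exact_mod_cast hX
    have h := sum_prod_normDensity_le f ω p hf
      (B := 1 + X * (size f K : ℝ) ^ 2) (by gcongr) ⟨0, hr⟩ (Nat.zero_le m)
    simp only [pow_zero, one_dvd, if_true, one_mul, mul_one] at h
    refine h.trans ?_
    rw [mul_comm]
    gcongr
    linarith

theorem localDensity_nonneg (hf : ∀ i, f i ≠ 0) : 0 ≤ localDensity f ω M a b p :=
  ge_of_tendsto' (tendsto_localDensityApprox f ω M a b p hf)
    fun m => localDensityApprox_nonneg f ω M a b p m

theorem abs_localDensity_le (hf : ∀ i, f i ≠ 0) {X : ℕ} (hX : p ≤ X) :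
    |localDensity f ω M a b p| ≤ densityBound (size f K) X := by
  rw [abs_of_nonneg (localDensity_nonneg f ω M a b p hf)]
  exact le_of_tendsto' (tendsto_localDensityApprox f ω M a b p hf)
    fun m => localDensityApprox_le f ω M a b p hf hX m

/-- The constant in the estimate `1 + O(p⁻²)` for large primes. -/
def largePrimeConst (L : ℕ) : ℝ :=
  8 * (4 * 2 ^ L) ^ 2 * (L : ℝ) ^ 3 * momentSeries (4 * 2 ^ L) L (L + 2)

theorem largePrimeConst_nonneg (L : ℕ) : 0 ≤ largePrimeConst L := by
  have := momentSeries_nonneg (B := 4 * 2 ^ L) (by positivity) L (L + 2)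
  unfold largePrimeConst
  positivity

theorem abs_localDensity_sub_one_le_of_lt (hf : ∀ i, f i ≠ 0)
    (hli : ∀ i j, i ≠ j → LinearIndependent ℤ ![f i, f j]) (hM : ¬ p ∣ M)
    (hpL : 2 * size f K ^ 2 + size f K < p) :
    |localDensity f ω M a b p - 1| ≤ largePrimeConst (size f K) / (p : ℝ) ^ 2 := by
  have hp0 : (0 : ℝ) < p := by exact_mod_cast hp.out.pos
  refine le_of_tendsto (((tendsto_localDensityApprox f ω M a b p hf).sub_const 1).abs) ?_
  filter_upwards [eventually_ne_atTop 0] with m hm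
  have h := abs_sum_prod_normDensity_sub_le f ω p hf hli hpL hm
  have h1 : localDensityApprox f ω M a b p m - 1 =
      ((∑ u : Fin s → ZMod (p ^ m), ∏ l, normDensity (ω l) p m (linForm (f l) (p ^ m) u)) -
        (p : ℝ) ^ (m * s)) / (p : ℝ) ^ (m * s) := by
    rw [localDensityApprox_eq, Finset.sum_congr rfl fun u _ => localTerm_eq f ω M a b p hM m u,
      sub_div, div_self (by positivity), one_div_mul_eq_div]
  rw [h1, abs_div, abs_of_pos (show (0 : ℝ) < (p : ℝ) ^ (m * s) by positivity),
    div_le_iff₀ (by positivity)]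
  refine h.trans (le_of_eq ?_)
  unfold largePrimeConst
  ring

/-- The constant in the estimate `1 + O(p⁻²)` for all primes. -/
def densityConst (L : ℕ) : ℝ :=
  largePrimeConst L + (1 + densityBound L (2 * L ^ 2 + L)) * ((2 * L ^ 2 + L : ℕ) : ℝ) ^ 2

/-- For p ≤ X = 2 L² + L a bounded density is enough, since X² / p² ≥ 1; this accounts for the
second summand of `densityConst`. -/
theorem abs_localDensity_sub_one_le (hf : ∀ i, f i ≠ 0)
    (hli : ∀ i j, i ≠ j → LinearIndependent ℤ ![f i, f j]) (hM : ¬ p ∣ M) :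
    |localDensity f ω M a b p - 1| ≤ densityConst (size f K) / (p : ℝ) ^ 2 := by
  have hp0 : (0 : ℝ) < p := by exact_mod_cast hp.out.pos
  have hb := densityBound_nonneg (size f K) (2 * size f K ^ 2 + size f K)
  have hl := largePrimeConst_nonneg (size f K)
  unfold densityConst
  rcases lt_or_ge (2 * size f K ^ 2 + size f K) p with hpL | hpL
  · refine (abs_localDensity_sub_one_le_of_lt f ω M a b p hf hli hM hpL).trans ?_
    gcongr
    exact le_add_of_nonneg_right (by positivity)
  · have h := abs_localDensity_le f ω M a b p hf hpL
    have hpL' : (p : ℝ) ≤ ((2 * size f K ^ 2 + size f K : ℕ) : ℝ) := by exact_mod_cast hpL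
    rw [le_div_iff₀ (by positivity)]
    have h1 : |localDensity f ω M a b p - 1| ≤
        1 + densityBound (size f K) (2 * size f K ^ 2 + size f K) :=
      (abs_sub _ _).trans (by rw [abs_one]; linarith)
    refine le_add_of_nonneg_of_le hl (mul_le_mul h1 ?_ (by positivity) (by positivity))
    gcongr

theorem localDensity_pos (hf : ∀ i, f i ≠ 0)
    (hli : ∀ i j, i ≠ j → LinearIndependent ℤ ![f i, f j]) (hM : ¬ p ∣ M)
    (hpL : ⌈densityConst (size f K)⌉₊ < p) : 0 < localDensity f ω M a b p := by
  have hp1 : (1 : ℝ) ≤ p := by exact_mod_cast hp.out.one_lt.le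
  have h := abs_localDensity_sub_one_le f ω M a b p hf hli hM
  have h1 : densityConst (size f K) < p := (Nat.le_ceil _).trans_lt (by exact_mod_cast hpL)
  -- The constant is less than p ≤ p².
  have h2 : densityConst (size f K) / (p : ℝ) ^ 2 < 1 := by
    rw [div_lt_one (by positivity)]
    nlinarith
  linarith [(abs_lt.1 (h.trans_lt h2)).1]

/-- Comparison with ∑ p^(-2), after discarding the finitely many primes dividing M. -/
theorem summable_abs_localDensity_sub_one (hf : ∀ i, f i ≠ 0)
    (hli : ∀ i j, i ≠ j → LinearIndependent ℤ ![f i, f j]) (hM : 0 < M) :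
    Summable fun p : Nat.Primes => |localDensity f ω M a b (p : ℕ) - 1| := by
  have hs : Summable fun p : Nat.Primes => densityConst (size f K) / ((p : ℕ) : ℝ) ^ 2 := by
    have h1 := (Real.summable_one_div_nat_pow (p := 2)).2 one_lt_two
    have h2 := (h1.comp_injective Nat.Primes.coe_nat_injective).mul_left (densityConst (size f K))
    refine h2.congr fun p => ?_
    simp [div_eq_mul_inv]
  have hfin : {p : Nat.Primes | (p : ℕ) ∣ M}.Finite :=
    Set.Finite.of_finite_image (f := fun p : Nat.Primes => (p : ℕ))
      ((Set.finite_Iic M).subset (by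
        rintro _ ⟨p, hp, rfl⟩
        exact Nat.le_of_dvd hM hp)) Nat.Primes.coe_nat_injective.injOn
  refine Summable.of_norm_bounded_eventually hs ?_
  filter_upwards [hfin.compl_mem_cofinite] with p hp
  rw [Real.norm_eq_abs, abs_abs]
  exact abs_localDensity_sub_one_le f ω M a b p hf hli hp

end Limit

end NormFormSystem

end

theorem proposition5p5 :
    ∃ (C : ℕ → ℝ) (C' : ℕ → ℕ → ℝ) (L' : ℕ → ℕ),
      ∀ (s r : ℕ) (f : Fin r → Fin s → ℤ)
        (_ : ∀ i, f i ≠ 0)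
        (_ : ∀ i j, i ≠ j → LinearIndependent ℤ ![f i, f j])
        (K : Fin r → Type*) [∀ i, Field (K i)] [∀ i, NumberField (K i)]
        (_ : ∀ i, 1 < Module.finrank ℚ (K i))
        (ω : ∀ i, Module.Basis (Fin (Module.finrank ℚ (K i))) ℤ (𝓞 (K i)))
        (M : ℕ) (_ : 0 < M)
        (a : Fin s → ZMod M) (b : ∀ i, Fin (Module.finrank ℚ (K i)) → ZMod M),
        -- the limits defining the local densities exist
        (∀ (p : ℕ) [Fact p.Prime],
          Tendsto (fun m : ℕ => NormFormSystem.localDensityApprox f ω M a b p m) atTop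
            (𝓝 (NormFormSystem.localDensity f ω M a b p))) ∧
        (∀ (p : ℕ) [Fact p.Prime], ¬ p ∣ M →
          |NormFormSystem.localDensity f ω M a b p - 1| ≤
            C (NormFormSystem.size f K) / (p : ℝ) ^ 2) ∧
        (∀ (p : ℕ) [Fact p.Prime], p ∣ M →
          |NormFormSystem.localDensity f ω M a b p| ≤ C' (NormFormSystem.size f K) M) ∧
        (∀ (p : ℕ) [Fact p.Prime], ¬ p ∣ M → L' (NormFormSystem.size f K) < p →
          0 < NormFormSystem.localDensity f ω M a b p) ∧
        -- the product of the local densities converges absolutely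
        Summable (fun p : Nat.Primes => |NormFormSystem.localDensity f ω M a b (p : ℕ) - 1|) ∧
        Multipliable (fun p : Nat.Primes => NormFormSystem.localDensity f ω M a b (p : ℕ)) := by
  -- A prime dividing M is at most M, so `densityBound` taken at X = M serves as the second
  -- constant.
  refine ⟨NormFormSystem.densityConst, NormFormSystem.densityBound,
    fun L => ⌈NormFormSystem.densityConst L⌉₊, ?_⟩
  intro s r f hf hli K _ _ _ ω M hM a b
  have hsum := NormFormSystem.summable_abs_localDensity_sub_one f ω M a b hf hli hM
  refine ⟨fun p _ => NormFormSystem.tendsto_localDensityApprox f ω M a b p hf,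
    fun p _ hp => NormFormSystem.abs_localDensity_sub_one_le f ω M a b p hf hli hp,
    fun p _ hp => NormFormSystem.abs_localDensity_le f ω M a b p hf (Nat.le_of_dvd hM hp),
    fun p _ hp hL => NormFormSystem.localDensity_pos f ω M a b p hf hli hp hL, hsum, ?_⟩
  have := multipliable_one_add_of_summable (R := ℝ) (f := fun p : Nat.Primes =>
    NormFormSystem.localDensity f ω M a b (p : ℕ) - 1) (by simpa [Real.norm_eq_abs] using hsum)
  simpa using this
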